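/- **Setting.** Let $n,p\ge 1$, $K\in\{1,\dots,p\}$, $\tau>0$, let $X\in\mathbb R^{n\times p}$ be deterministic, $\beta\in\mathbb R^p$, and $Y=X\beta+\varepsilon$ with $\varepsilon\sim\mathcal N_n(0,\tau^2I_n)$. Put $\Sigma=\frac1nX^TX$, $\hat\sigma=\frac1nX^TY$ and $\sigma=\mathbb E(\hat\sigma)$. For a matrix $A$, $[A]$ is the span of its columns; for a symmetric matrix $A$, $\rho(A)$ and $\rho_{\min}(A)$ are its highest and lowest eigenvalues, and $\mathrm{Cond}(A)=\rho(A)/\rho_{\min}(A)$ if $A$ is positive definite; $\|\cdot\|$ is the Euclidean norm. *PLS estimator.* Set $X^{(1)}=X$ and, for $k=1,\dots,K$, $w_k=X^{(k)T}Y/\|X^{(k)T}Y\|$, $t_k=X^{(k)}w_k$, $X^{(k+1)}=X^{(k)}-P_{[t_k]}X^{(k)}$, where $P_{[t_k]}$ is the orthogonal projection onto the line spanned by $t_k$ (with $w_k=0$ and $P_{[t_k]}=0$ when $X^{(k)T}Y=0$). The estimator $\hat\beta_K$ is a minimiser of $b\mapsto\|Y-Xb\|^2$ over $\mathrm{span}(w_1,\dots,w_K)$.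 *Krylov components.* Let $G=(\sigma,\Sigma\sigma,\dots,\Sigma^{K-1}\sigma)\in\mathbb R^{p\times K}$, $\Theta=G^T\Sigma G$, $D=\mathrm{diag}(\Theta)$, $R=D^{-1/2}\Theta D^{-1/2}$ and $\Lambda=\Theta^{-1}G^T\sigma$. **Theorem 3.1.** For every $\delta\in(0,1)$ and every matrix $R$ there is a constant $D_{\delta,R}$, depending only on $\delta$ and $R$, such that the following holds for all $n,p,X,\beta,\tau$ as above whose correlation matrix is $R$. Assume * (A.1) $D$ is invertible and $\rho_{\min}(R)>0$; * (A.2) for some $t_{\delta,R}\ge 128\,\dfrac{\ln(6K/\delta)}{\rho_{\min}(R)}$, $$\sigma^T\Sigma^{2i-1}\sigma\ \ge\ t_{\delta,R}\,\frac{\tau^2}{n}\,K\,\rho(\Sigma)^i\,\mathrm{Tr}(\Sigma^i)\qquad\text{for all } i\in\{1,\dots,K\}.$$ Then, with probability at least $1-\delta$, $$\frac1n\|X\hat\beta_K-X\beta\|^2\le\frac2n\inf_{v\in[G]}\|X(\beta-v)\|^2+D_{\delta,R}\frac{\tau^2}{n}\max\Bigl(\mathrm{Cond}(D)\|\Lambda\|^2\sum_{i=1}^K\mathrm{Tr}(\Sigma^{2i}),\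 \sqrt{\mathrm{Cond}(D)\|\Lambda\|^2\sum_{i=1}^K\mathrm{Tr}(\Sigma^i)^2}\Bigr).$$ -/

import Mathlib

open MeasureTheory ProbabilityTheory Matrix

noncomputable section

namespace PLS

/-- The Euclidean norm of a real vector. -/
def l2norm {ι : Type*} [Fintype ι] (v : ι → ℝ) : ℝ := ‖WithLp.toLp 2 v‖

/-- The highest eigenvalue of a symmetric real matrix. -/
def rhoMax {ι : Type*} [Fintype ι] [DecidableEq ι] (A : Matrix ι ι ℝ) : ℝ :=
  sSup (spectrum ℝ A)

/-- The lowest eigenvalue of a symmetric real matrix. -/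
def rhoMin {ι : Type*} [Fintype ι] [DecidableEq ι] (A : Matrix ι ι ℝ) : ℝ :=
  sInf (spectrum ℝ A)

/-- The condition number of a positive definite matrix. -/
def cond {ι : Type*} [Fintype ι] [DecidableEq ι] (A : Matrix ι ι ℝ) : ℝ :=
  rhoMax A / rhoMin A

/-- The subspace spanned by the columns of a matrix. -/
def colSpan {p s : ℕ} (A : Matrix (Fin p) (Fin s) ℝ) : Submodule ℝ (Fin p → ℝ) :=
  Submodule.span ℝ (Set.range fun j : Fin s => A.col j)

/-! ### The linear model -/

/-- The Gram matrix `(1/n) Xᵀ X`. -/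
def gramMatrix {n p : ℕ} (X : Matrix (Fin n) (Fin p) ℝ) : Matrix (Fin p) (Fin p) ℝ :=
  (1 / (n : ℝ)) • (Xᵀ * X)

/-- The response `Y = X β + ε`. -/
def response {n p : ℕ} (X : Matrix (Fin n) (Fin p) ℝ) (β : Fin p → ℝ)
    (e : EuclideanSpace ℝ (Fin n)) : Fin n → ℝ :=
  X *ᵥ β + e.ofLp

/-- The empirical covariance `(1/n) Xᵀ Y` between the design and the response. -/
def empCov {n p : ℕ} (X : Matrix (Fin n) (Fin p) ℝ) (Y : Fin n → ℝ) : Fin p → ℝ :=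
  (1 / (n : ℝ)) • (Xᵀ *ᵥ Y)

/-- The population covariance: the expectation of the empirical covariance with respect to
the noise. -/
def popCov {n p : ℕ} {Ω : Type*} [MeasurableSpace Ω] (P : Measure Ω)
    (X : Matrix (Fin n) (Fin p) ℝ) (β : Fin p → ℝ)
    (ε : Ω → EuclideanSpace ℝ (Fin n)) : Fin p → ℝ :=
  ∫ ω, empCov X (response X β (ε ω)) ∂P

/-! ### The PLS algorithm -/

/-- The matrix of the orthogonal projection of `ℝⁿ` onto the line spanned by `t`
(it is `0` when `t = 0`). -/
def projLine {n : ℕ} (t : Fin n → ℝ) : Matrix (Fin n) (Fin n) ℝ :=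
  (t ⬝ᵥ t)⁻¹ • vecMulVec t t

/-- The loading `AᵀY / ‖AᵀY‖` computed from a (deflated) design matrix `A`. -/
def loadingOf {n p : ℕ} (A : Matrix (Fin n) (Fin p) ℝ) (Y : Fin n → ℝ) : Fin p → ℝ :=
  (l2norm (Aᵀ *ᵥ Y))⁻¹ • (Aᵀ *ᵥ Y)

/-- The PLS component `t = A w` computed from a (deflated) design matrix `A`. -/
def componentOf {n p : ℕ} (A : Matrix (Fin n) (Fin p) ℝ) (Y : Fin n → ℝ) : Fin n → ℝ :=
  A *ᵥ loadingOf A Y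

/-- The successive deflated designs: `deflated X Y k` is the design at the start of the
iteration number `k + 1`. -/
def deflated {n p : ℕ} (X : Matrix (Fin n) (Fin p) ℝ) (Y : Fin n → ℝ) :
    ℕ → Matrix (Fin n) (Fin p) ℝ
  | 0 => X
  | k + 1 => deflated X Y k - projLine (componentOf (deflated X Y k) Y) * deflated X Y k

/-- The matrix whose columns are the first `K` PLS loadings. -/
def loadings {n p : ℕ} (X : Matrix (Fin n) (Fin p) ℝ) (Y : Fin n → ℝ) (K : ℕ) :
    Matrix (Fin p) (Fin K) ℝ :=
  Matrix.of fun i k => loadingOf (deflated X Y k) Y i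

/-- `b` is a PLS estimate with `K` components: it minimises `‖Y - X b‖²` over the span of
the first `K` loadings. -/
def IsPLSEstimate {n p : ℕ} (X : Matrix (Fin n) (Fin p) ℝ) (Y : Fin n → ℝ) (K : ℕ)
    (b : Fin p → ℝ) : Prop :=
  b ∈ colSpan (loadings X Y K) ∧
    ∀ c ∈ colSpan (loadings X Y K), l2norm (Y - X *ᵥ b) ^ 2 ≤ l2norm (Y - X *ᵥ c) ^ 2

/-! ### Krylov components

`S` stands for the Gram matrix and `s` for the population covariance. -/

/-- `G = (s, S s, …, S^(K-1) s)`. -/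
def krylov {p : ℕ} (S : Matrix (Fin p) (Fin p) ℝ) (s : Fin p → ℝ) (K : ℕ) :
    Matrix (Fin p) (Fin K) ℝ :=
  Matrix.of fun i j => (S ^ (j : ℕ) *ᵥ s) i

/-- `Θ = Gᵀ S G`. -/
def theta {p : ℕ} (S : Matrix (Fin p) (Fin p) ℝ) (s : Fin p → ℝ) (K : ℕ) :
    Matrix (Fin K) (Fin K) ℝ :=
  (krylov S s K)ᵀ * S * krylov S s K

/-- `Λ = Θ⁻¹ Gᵀ s`. -/
def lam {p : ℕ} (S : Matrix (Fin p) (Fin p) ℝ) (s : Fin p → ℝ) (K : ℕ) : Fin K → ℝ :=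
  (theta S s K)⁻¹ *ᵥ ((krylov S s K)ᵀ *ᵥ s)

/-- `D`, the diagonal part of `Θ`. -/
def diagPart {p : ℕ} (S : Matrix (Fin p) (Fin p) ℝ) (s : Fin p → ℝ) (K : ℕ) :
    Matrix (Fin K) (Fin K) ℝ :=
  Matrix.diagonal fun i => theta S s K i i

/-- `D^(-1/2)`. -/
def diagInvSqrt {p : ℕ} (S : Matrix (Fin p) (Fin p) ℝ) (s : Fin p → ℝ) (K : ℕ) :
    Matrix (Fin K) (Fin K) ℝ :=
  Matrix.diagonal fun i => (Real.sqrt (theta S s K i i))⁻¹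

/-- The correlation matrix `R = D^(-1/2) Θ D^(-1/2)`. If some diagonal entry of `Θ`
vanishes, so that `D` is not invertible, the corresponding row and column of `R` are zero
here, and hence `rhoMin R ≤ 0`. -/
def corr {p : ℕ} (S : Matrix (Fin p) (Fin p) ℝ) (s : Fin p → ℝ) (K : ℕ) :
    Matrix (Fin K) (Fin K) ℝ :=
  diagInvSqrt S s K * theta S s K * diagInvSqrt S s K

end PLS

end

/-!
Put `A = X / √n`, `f = A β` and `g = ε / √n`, so that `S = AᵀA` and `σ = Aᵀ f`. The PLS fit is the
projection of `f + g` onto the span of the `K` vectors `A Sʲ Aᵀ (f + g)`, `j < K`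
(`IsPLSEstimate.leastSquares_krylov`): the loadings are orthogonal and lie in the empirical Krylov
space, so they span it, unless one of them vanishes, in which case the fit is already the
projection onto the whole range of `A`.

A projection `h` of `f + g` satisfies `‖h - f‖² ≤ ‖f - v‖² + κ²` for every `v` in the space
projected on, where `κ` is the norm of the projection of `g` (`leastSquares_le`). Take for `v` the
combination of the `A Sʲ Aᵀ (f + g)` with the population coefficients `Λ`. Since `A G Λ` is the
projection of `f` onto `A [G]`, the term `‖f - v‖²` is at most twice the approximation error plus
twice `‖∑ⱼ Λⱼ A Sʲ Aᵀ g‖²`. For `κ²`, the columns `A Sʲ Aᵀ (f + g)` divided by the square roots of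
the diagonal entries `Θⱼⱼ` have Gram matrix `R` up to a noise term, which the second assumption
makes smaller than `ρ_min(R)`; so `κ²` is at most `4 / ρ_min(R)` times the sum of the squared
inner products of `g` with these normalised columns (`sum_theta_mul_sq_le`).

All noise terms that occur are quadratic forms `gᵀ B g` with `B` positive semidefinite: `A Sʲ Aᵀ`,
its square, and a rank one matrix. By convexity of the exponential, such a form exceeds
`4 x (τ² / n) Tr B` with probability at most `√2 exp (-x)` (`measure_quadraticForm_gt_le`), and
there are `3 K` of them. Finally, the terms of `κ²` that do not contain `Λ` are absorbed by the
maximum in the bound, because `ΘΛ = Gᵀσ` forces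
`1 ≤ ρ(S)^(2i) ‖R‖_F² Cond(D) ‖Λ‖²` for `1 ≤ i ≤ K` (`one_le_rhoMax_pow_mul`).
-/

namespace PLS

/-! ### Euclidean norms and extreme eigenvalues -/

lemma l2norm_sq {ι : Type*} [Fintype ι] (v : ι → ℝ) : l2norm v ^ 2 = v ⬝ᵥ v := by
  rw [l2norm, EuclideanSpace.real_norm_sq_eq]
  simp [dotProduct, sq]

lemma l2norm_eq_zero {ι : Type*} [Fintype ι] {v : ι → ℝ} : l2norm v = 0 ↔ v = 0 := by
  simp [l2norm]

lemma zero_le_dotProduct_self {ι : Type*} [Fintype ι] (v : ι → ℝ) : 0 ≤ v ⬝ᵥ v :=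
  Finset.sum_nonneg fun i _ => mul_self_nonneg (v i)

section Spectral

variable {ι : Type*} [Fintype ι] [DecidableEq ι] {A : Matrix ι ι ℝ}

lemma pow_eq_eigenvectorUnitary (hA : A.IsHermitian) (k : ℕ) :
    A ^ k = (hA.eigenvectorUnitary : Matrix ι ι ℝ) * diagonal (fun i => hA.eigenvalues i ^ k) *
      (hA.eigenvectorUnitary : Matrix ι ι ℝ)ᵀ := by
  have h := congrArg (· ^ k) hA.spectral_theorem
  simp only [← map_pow, diagonal_pow] at h
  rw [h, Unitary.conjStarAlgAut_apply, star_eq_conjTranspose, conjTranspose_eq_transpose_of_trivial]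
  rfl

lemma dotProduct_pow_mulVec (hA : A.IsHermitian) (k : ℕ) (z : ι → ℝ) :
    z ⬝ᵥ (A ^ k *ᵥ z) = ∑ i, hA.eigenvalues i ^ k *
      (((hA.eigenvectorUnitary : Matrix ι ι ℝ)ᵀ *ᵥ z) i) ^ 2 := by
  rw [pow_eq_eigenvectorUnitary hA, ← mulVec_mulVec, ← mulVec_mulVec, dotProduct_mulVec,
    ← mulVec_transpose]
  simp only [dotProduct, mulVec_diagonal]
  exact Finset.sum_congr rfl fun i _ => by ring

lemma dotProduct_self_eq_sum (hA : A.IsHermitian) (z : ι → ℝ) :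
    z ⬝ᵥ z = ∑ i, (((hA.eigenvectorUnitary : Matrix ι ι ℝ)ᵀ *ᵥ z) i) ^ 2 := by
  simpa using dotProduct_pow_mulVec hA 0 z

lemma trace_pow_eq_sum (hA : A.IsHermitian) (k : ℕ) :
    (A ^ k).trace = ∑ i, hA.eigenvalues i ^ k := by
  have h := Unitary.coe_star_mul_self hA.eigenvectorUnitary
  rw [star_eq_conjTranspose, conjTranspose_eq_transpose_of_trivial] at h
  rw [pow_eq_eigenvectorUnitary hA, trace_mul_comm, ← mul_assoc, h, one_mul, trace_diagonal]

lemma finite_spectrum (hA : A.IsHermitian) : (spectrum ℝ A).Finite := by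
  rw [hA.spectrum_real_eq_range_eigenvalues]
  exact Set.finite_range _

lemma eigenvalues_le_rhoMax (hA : A.IsHermitian) (i : ι) : hA.eigenvalues i ≤ rhoMax A :=
  le_csSup (finite_spectrum hA).bddAbove (hA.eigenvalues_mem_spectrum_real i)

lemma rhoMin_le_eigenvalues (hA : A.IsHermitian) (i : ι) : rhoMin A ≤ hA.eigenvalues i :=
  csInf_le (finite_spectrum hA).bddBelow (hA.eigenvalues_mem_spectrum_real i)

lemma rhoMin_mul_le (hA : A.IsHermitian) (z : ι → ℝ) :
    rhoMin A * (z ⬝ᵥ z) ≤ z ⬝ᵥ (A *ᵥ z) := by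
  have h := dotProduct_pow_mulVec hA 1 z
  rw [pow_one] at h
  rw [h, dotProduct_self_eq_sum hA, Finset.mul_sum]
  refine Finset.sum_le_sum fun i _ => ?_
  rw [pow_one]
  exact mul_le_mul_of_nonneg_right (rhoMin_le_eigenvalues hA i) (sq_nonneg _)

/-- For a positive semidefinite `A`, `A ^ (a + b) ≤ ρ(A) ^ b A ^ a` in the Loewner order. -/
lemma dotProduct_pow_add_mulVec_le (hA : A.PosSemidef) (a b : ℕ) (z : ι → ℝ) :
    z ⬝ᵥ (A ^ (a + b) *ᵥ z) ≤ rhoMax A ^ b * (z ⬝ᵥ (A ^ a *ᵥ z)) := by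
  rw [dotProduct_pow_mulVec hA.1, dotProduct_pow_mulVec hA.1, Finset.mul_sum]
  refine Finset.sum_le_sum fun i _ => ?_
  rw [pow_add, ← mul_assoc]
  refine mul_le_mul_of_nonneg_right ?_ (sq_nonneg _)
  rw [mul_comm]
  exact mul_le_mul_of_nonneg_right
    (pow_le_pow_left₀ (hA.eigenvalues_nonneg i) (eigenvalues_le_rhoMax hA.1 i) b)
    (pow_nonneg (hA.eigenvalues_nonneg i) a)

/-- Without `Nonempty` the spectrum is empty and `rhoMax` is the junk value `sSup ∅ = 0`. -/
lemma exists_eigenvalues_eq_rhoMax [Nonempty ι] (hA : A.IsHermitian) :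
    ∃ i, hA.eigenvalues i = rhoMax A := by
  have hne : (spectrum ℝ A).Nonempty :=
    ⟨_, hA.eigenvalues_mem_spectrum_real (Classical.arbitrary ι)⟩
  have h := hne.csSup_mem (finite_spectrum hA)
  rw [hA.spectrum_real_eq_range_eigenvalues] at h
  obtain ⟨i, hi⟩ := h
  refine ⟨i, hi.trans ?_⟩
  rw [rhoMax, hA.spectrum_real_eq_range_eigenvalues]

lemma rhoMax_nonneg [Nonempty ι] (hA : A.PosSemidef) : 0 ≤ rhoMax A := by
  obtain ⟨i, hi⟩ := exists_eigenvalues_eq_rhoMax hA.1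
  exact hi ▸ hA.eigenvalues_nonneg i

lemma rhoMax_pow_le_trace [Nonempty ι] (hA : A.PosSemidef) (k : ℕ) :
    rhoMax A ^ k ≤ (A ^ k).trace := by
  obtain ⟨i, hi⟩ := exists_eigenvalues_eq_rhoMax hA.1
  rw [trace_pow_eq_sum hA.1, ← hi]
  exact Finset.single_le_sum (f := fun i => hA.1.eigenvalues i ^ k)
    (fun j _ => pow_nonneg (hA.eigenvalues_nonneg j) k) (Finset.mem_univ i)

end Spectral

section Diagonal

variable {ι : Type*} [Fintype ι] [DecidableEq ι] {d : ι → ℝ}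

lemma le_rhoMax_diagonal (d : ι → ℝ) (i : ι) : d i ≤ rhoMax (diagonal d) := by
  rw [rhoMax, spectrum_diagonal]
  exact le_csSup (Set.finite_range d).bddAbove ⟨i, rfl⟩

lemma rhoMin_diagonal_le (d : ι → ℝ) (i : ι) : rhoMin (diagonal d) ≤ d i := by
  rw [rhoMin, spectrum_diagonal]
  exact csInf_le (Set.finite_range d).bddBelow ⟨i, rfl⟩

lemma rhoMin_diagonal_pos [Nonempty ι] (hd : ∀ i, 0 < d i) :
    0 < rhoMin (diagonal d) := by
  rw [rhoMin, spectrum_diagonal]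
  obtain ⟨i, hi⟩ := (Set.range_nonempty d).csInf_mem (Set.finite_range d)
  exact hi ▸ hd i

lemma one_le_cond_diagonal [Nonempty ι] (hd : ∀ i, 0 < d i) :
    1 ≤ cond (diagonal d) := by
  rw [cond, one_le_div (rhoMin_diagonal_pos hd)]
  exact (rhoMin_diagonal_le d (Classical.arbitrary ι)).trans (le_rhoMax_diagonal d _)

end Diagonal

/-! ### Gaussian quadratic forms -/

open scoped NNReal

/-- The density of `N(0, v)` times `exp (x² / (4 v))` is `√2` times the density of `N(0, 2 v)`. -/
lemma lintegral_exp_sq_gaussianReal {v : ℝ≥0} (hv : v ≠ 0) :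
    ∫⁻ x, ENNReal.ofReal (Real.exp (x ^ 2 / (4 * v))) ∂(gaussianReal 0 v) =
      ENNReal.ofReal (Real.sqrt 2) := by
  have hv' : (0 : ℝ) < v := by positivity
  rw [gaussianReal_of_var_ne_zero 0 hv,
    lintegral_withDensity_eq_lintegral_mul _ (measurable_gaussianPDF 0 v) (by fun_prop)]
  have key : ∀ x : ℝ, (gaussianPDF 0 v * fun x : ℝ => ENNReal.ofReal (Real.exp (x ^ 2 / (4 * v)))) x
      = ENNReal.ofReal (Real.sqrt 2) * gaussianPDF 0 (2 * v) x := by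
    intro x
    rw [Pi.mul_apply, gaussianPDF_def, gaussianPDF_def,
      ← ENNReal.ofReal_mul (gaussianPDFReal_nonneg _ _ _), ← ENNReal.ofReal_mul (by positivity)]
    congr 1
    rw [gaussianPDFReal_def, gaussianPDFReal_def, mul_assoc, ← Real.exp_add]
    have h1 : -(x - 0) ^ 2 / (2 * (v : ℝ)) + x ^ 2 / (4 * v)
        = -(x - 0) ^ 2 / (2 * ((2 * v : ℝ≥0) : ℝ)) := by
      push_cast
      field_simp
      ring
    have h2 : Real.sqrt (2 * Real.pi * ((2 * v : ℝ≥0) : ℝ))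
        = Real.sqrt 2 * Real.sqrt (2 * Real.pi * v) := by
      rw [← Real.sqrt_mul (by norm_num)]
      congr 1
      push_cast
      ring
    rw [h1, h2, mul_inv, ← mul_assoc, mul_inv_cancel_left₀ (by positivity)]
  simp_rw [key]
  rw [lintegral_const_mul _ (measurable_gaussianPDF 0 _),
    lintegral_gaussianPDF_eq_one 0 (by simpa using hv), mul_one]

lemma posSemidef_sq_smul_one {n : ℕ} (τ : ℝ) :
    (τ ^ 2 • (1 : Matrix (Fin n) (Fin n) ℝ)).PosSemidef :=
  PosSemidef.one.smul (sq_nonneg τ)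

lemma map_inner_multivariateGaussian {n : ℕ} (τ : ℝ) {u : EuclideanSpace ℝ (Fin n)}
    (hu : ‖u‖ = 1) :
    (multivariateGaussian 0 (τ ^ 2 • (1 : Matrix (Fin n) (Fin n) ℝ))).map (innerSL ℝ u) =
      gaussianReal 0 (τ ^ 2).toNNReal := by
  rw [IsGaussian.map_eq_gaussianReal]
  congr 1
  · rw [ContinuousLinearMap.integral_comp_id_comm IsGaussian.integrable_id]
    simp
  · congr 1
    have h := covarianceBilin_self (μ := multivariateGaussian 0
      (τ ^ 2 • (1 : Matrix (Fin n) (Fin n) ℝ))) IsGaussian.memLp_two_id u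
    rw [covarianceBilin_multivariateGaussian (posSemidef_sq_smul_one τ)] at h
    have h2 : (u.ofLp ⬝ᵥ u.ofLp) = 1 := by
      have := EuclideanSpace.real_norm_sq_eq u
      rw [hu] at this
      simpa [dotProduct, sq] using this.symm
    rw [smul_mulVec, one_mulVec, dotProduct_smul, h2, smul_eq_mul, mul_one] at h
    exact h.symm

/-- Exponential tail bound for a positive semidefinite quadratic form in Gaussian noise. Writing
the form as a weighted sum of squares of centred Gaussian variables, the convexity of `exp`
reduces its exponential moment to that of one such square; independence plays no role. -/
lemma measure_quadraticForm_gt_le {n : ℕ} {τ : ℝ} (hτ : 0 < τ) {Ω : Type*} [MeasurableSpace Ω]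
    {P : Measure Ω} {ε : Ω → EuclideanSpace ℝ (Fin n)}
    (hε : HasLaw ε (multivariateGaussian 0 (τ ^ 2 • (1 : Matrix (Fin n) (Fin n) ℝ))) P)
    {B : Matrix (Fin n) (Fin n) ℝ} (hB : B.PosSemidef) (L : ℝ) :
    P {ω | L * τ ^ 2 * B.trace < (ε ω).ofLp ⬝ᵥ (B *ᵥ (ε ω).ofLp)} ≤
      ENNReal.ofReal (Real.sqrt 2 * Real.exp (-(L / 4))) := by
  set γ := multivariateGaussian 0 (τ ^ 2 • (1 : Matrix (Fin n) (Fin n) ℝ))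
  have hcont : Continuous fun x : EuclideanSpace ℝ (Fin n) => x.ofLp ⬝ᵥ (B *ᵥ x.ofLp) := by
    fun_prop
  rw [hε.measure_eq (p := fun x => L * τ ^ 2 * B.trace < x.ofLp ⬝ᵥ (B *ᵥ x.ofLp))
    (measurableSet_lt measurable_const hcont.measurable)]
  set l := hB.1.eigenvalues
  set e := hB.1.eigenvectorBasis
  have hform : ∀ x : EuclideanSpace ℝ (Fin n),
      x.ofLp ⬝ᵥ (B *ᵥ x.ofLp) = ∑ i, l i * (innerSL ℝ (e i) x) ^ 2 := by
    intro x
    have h := dotProduct_pow_mulVec hB.1 1 x.ofLp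
    simp only [pow_one] at h
    rw [h]
    refine Finset.sum_congr rfl fun i _ => ?_
    congr 2
    simp only [mulVec, dotProduct, transpose_apply, IsHermitian.eigenvectorUnitary_apply,
      innerSL_apply_apply, PiLp.inner_apply]
    exact Finset.sum_congr rfl fun j _ => by simp [mul_comm, e]
  have htr : B.trace = ∑ i, l i := by simpa using trace_pow_eq_sum hB.1 1
  have hl : ∀ i, 0 ≤ l i := hB.eigenvalues_nonneg
  rcases (Finset.sum_nonneg fun i (_ : i ∈ Finset.univ) => hl i).eq_or_lt with h0 | hpos
  · have hz : ∀ i, l i = 0 := fun i =>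
      (Finset.sum_eq_zero_iff_of_nonneg fun i _ => hl i).1 h0.symm i (Finset.mem_univ i)
    have : {x : EuclideanSpace ℝ (Fin n) | L * τ ^ 2 * B.trace < x.ofLp ⬝ᵥ (B *ᵥ x.ofLp)} = ∅ := by
      ext x
      simp [hform, htr, hz]
    simp [this]
  set T := ∑ i, l i
  -- Jensen's inequality with the weights `l i / T`, which sum to one.
  have hmom : ∫⁻ x, ENNReal.ofReal
      (Real.exp (∑ i, (l i / T) * ((innerSL ℝ (e i) x) ^ 2 / (4 * τ ^ 2)))) ∂γ ≤
      ENNReal.ofReal (Real.sqrt 2) := by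
    have hone : ∀ i, ∫⁻ x, ENNReal.ofReal (Real.exp ((innerSL ℝ (e i) x) ^ 2 / (4 * τ ^ 2))) ∂γ =
        ENNReal.ofReal (Real.sqrt 2) := by
      intro i
      have hm := map_inner_multivariateGaussian τ (e.orthonormal.1 i)
      have hv : (τ ^ 2).toNNReal ≠ 0 := by simpa using hτ.ne'
      have h := lintegral_exp_sq_gaussianReal hv
      rw [← hm, lintegral_map (by fun_prop) (by fun_prop), Real.coe_toNNReal _ (sq_nonneg τ)] at h
      exact h
    calc _ ≤ ∫⁻ x, ∑ i, ENNReal.ofReal (l i / T) *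
          ENNReal.ofReal (Real.exp ((innerSL ℝ (e i) x) ^ 2 / (4 * τ ^ 2))) ∂γ := by
          refine lintegral_mono fun x => ?_
          have hj := convexOn_exp.map_sum_le (t := Finset.univ) (w := fun i => l i / T)
            (p := fun i => (innerSL ℝ (e i) x) ^ 2 / (4 * τ ^ 2))
            (fun i _ => div_nonneg (hl i) hpos.le)
            (by rw [← Finset.sum_div]; exact div_self hpos.ne') (fun i _ => Set.mem_univ _)
          simp only [smul_eq_mul] at hj
          refine (ENNReal.ofReal_le_ofReal hj).trans (le_of_eq ?_)
          rw [ENNReal.ofReal_sum_of_nonneg fun i _ =>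
            mul_nonneg (div_nonneg (hl i) hpos.le) (Real.exp_nonneg _)]
          exact Finset.sum_congr rfl fun i _ => ENNReal.ofReal_mul (div_nonneg (hl i) hpos.le)
      _ = ∑ i, ENNReal.ofReal (l i / T) * ENNReal.ofReal (Real.sqrt 2) := by
          rw [lintegral_finsetSum _ fun i _ => by fun_prop]
          refine Finset.sum_congr rfl fun i _ => ?_
          rw [lintegral_const_mul _ (by fun_prop), hone]
      _ = ENNReal.ofReal (Real.sqrt 2) := by
          rw [← Finset.sum_mul, ← ENNReal.ofReal_sum_of_nonneg fun i _ =>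
            div_nonneg (hl i) hpos.le, ← Finset.sum_div, div_self hpos.ne', ENNReal.ofReal_one,
            one_mul]
  have hexp : (0 : ℝ) < Real.exp (L / 4) := Real.exp_pos _
  calc γ {x | L * τ ^ 2 * B.trace < x.ofLp ⬝ᵥ (B *ᵥ x.ofLp)}
      ≤ γ {x | ENNReal.ofReal (Real.exp (L / 4)) ≤ ENNReal.ofReal
          (Real.exp (∑ i, (l i / T) * ((innerSL ℝ (e i) x) ^ 2 / (4 * τ ^ 2))))} := by
        refine measure_mono fun x hx => ?_
        simp only [Set.mem_ofPred_eq] at hx ⊢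
        refine ENNReal.ofReal_le_ofReal (Real.exp_le_exp.2 ?_)
        rw [hform, htr] at hx
        have h : ∑ i, (l i / T) * ((innerSL ℝ (e i) x) ^ 2 / (4 * τ ^ 2)) =
            (∑ i, l i * (innerSL ℝ (e i) x) ^ 2) / (4 * τ ^ 2 * T) := by
          rw [Finset.sum_div]
          exact Finset.sum_congr rfl fun i _ => by rw [div_mul_div_comm, mul_comm T]
        rw [h, le_div_iff₀ (by positivity)]
        linarith
    _ ≤ (∫⁻ x, ENNReal.ofReal
          (Real.exp (∑ i, (l i / T) * ((innerSL ℝ (e i) x) ^ 2 / (4 * τ ^ 2)))) ∂γ) /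
          ENNReal.ofReal (Real.exp (L / 4)) :=
        meas_ge_le_lintegral_div (by fun_prop) (by simpa using hexp) ENNReal.ofReal_ne_top
    _ ≤ ENNReal.ofReal (Real.sqrt 2) / ENNReal.ofReal (Real.exp (L / 4)) := by gcongr
    _ = ENNReal.ofReal (Real.sqrt 2 * Real.exp (-(L / 4))) := by
        rw [← ENNReal.ofReal_div_of_pos hexp, Real.exp_neg, div_eq_mul_inv]

/-- The population covariance is `S β`, because the noise is integrable and centred. -/
lemma popCov_eq {n p : ℕ} {τ : ℝ} {Ω : Type*} [MeasurableSpace Ω]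
    {P : Measure Ω} [IsProbabilityMeasure P] {ε : Ω → EuclideanSpace ℝ (Fin n)}
    (hε : HasLaw ε (multivariateGaussian 0 (τ ^ 2 • (1 : Matrix (Fin n) (Fin n) ℝ))) P)
    (X : Matrix (Fin n) (Fin p) ℝ) (β : Fin p → ℝ) :
    popCov P X β ε = gramMatrix X *ᵥ β := by
  set γ := multivariateGaussian 0 (τ ^ 2 • (1 : Matrix (Fin n) (Fin n) ℝ))
  let T : EuclideanSpace ℝ (Fin n) →L[ℝ] (Fin p → ℝ) :=
    LinearMap.toContinuousLinearMap
      ((1 / (n : ℝ)) • (Xᵀ.mulVecLin ∘ₗ (WithLp.linearEquiv 2 ℝ (Fin n → ℝ)).toLinearMap))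
  have hT : ∀ ω, empCov X (response X β (ε ω)) = gramMatrix X *ᵥ β + T (ε ω) := by
    intro ω
    simp [T, empCov, response, gramMatrix, mulVec_add, mulVec_mulVec, smul_mulVec, mulVec_transpose]
  have hint : Integrable ε P := by
    have h : Integrable id (P.map ε) := hε.map_eq ▸ IsGaussian.integrable_id
    exact h.comp_aemeasurable hε.aemeasurable
  have hmean : ∫ ω, ε ω ∂P = 0 := by
    rw [hε.integral_eq]
    simp [γ]
  simp_rw [popCov, hT]
  rw [integral_add (integrable_const _) (T.integrable_comp hint), T.integral_comp_comm hint, hmean]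
  simp

/-- Simultaneous control of finitely many positive semidefinite quadratic forms. -/
lemma le_measure_forall_quadraticForm_le {n : ℕ} {τ : ℝ} (hτ : 0 < τ) {Ω : Type*}
    [MeasurableSpace Ω] {P : Measure Ω} [IsProbabilityMeasure P]
    {ε : Ω → EuclideanSpace ℝ (Fin n)}
    (hε : HasLaw ε (multivariateGaussian 0 (τ ^ 2 • (1 : Matrix (Fin n) (Fin n) ℝ))) P)
    {ι : Type*} [Fintype ι] {B : ι → Matrix (Fin n) (Fin n) ℝ} (hB : ∀ i, (B i).PosSemidef)
    (L : ℝ) :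
    ENNReal.ofReal (1 - Fintype.card ι * (Real.sqrt 2 * Real.exp (-(L / 4)))) ≤
      P {ω | ∀ i, (ε ω).ofLp ⬝ᵥ (B i *ᵥ (ε ω).ofLp) ≤ L * τ ^ 2 * (B i).trace} := by
  set G := {ω | ∀ i, (ε ω).ofLp ⬝ᵥ (B i *ᵥ (ε ω).ofLp) ≤ L * τ ^ 2 * (B i).trace}
  have hsub : (Set.univ : Set Ω) ⊆
      G ∪ ⋃ i, {ω | L * τ ^ 2 * (B i).trace < (ε ω).ofLp ⬝ᵥ (B i *ᵥ (ε ω).ofLp)} := by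
    intro ω _
    by_cases h : ω ∈ G
    · exact Or.inl h
    · refine Or.inr (Set.mem_iUnion.2 ?_)
      simpa [G] using h
  have h1 : (1 : ENNReal) ≤
      P G + ENNReal.ofReal (Fintype.card ι * (Real.sqrt 2 * Real.exp (-(L / 4)))) := by
    calc (1 : ENNReal) = P Set.univ := measure_univ.symm
      _ ≤ _ := measure_mono hsub
      _ ≤ _ := measure_union_le _ _
      _ ≤ P G + ∑ _i : ι, ENNReal.ofReal (Real.sqrt 2 * Real.exp (-(L / 4))) := by
        refine add_le_add le_rfl ((measure_iUnion_fintype_le _ _).trans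
          (Finset.sum_le_sum fun i _ => measure_quadraticForm_gt_le hτ hε (hB i) L))
      _ = _ := by
        rw [Finset.sum_const, Finset.card_univ, nsmul_eq_mul,
          ENNReal.ofReal_mul (Nat.cast_nonneg _), ENNReal.ofReal_natCast]
  rw [ENNReal.ofReal_sub _ (by positivity), ENNReal.ofReal_one]
  exact tsub_le_iff_right.2 h1

/-! ### The PLS algorithm and the empirical Krylov space -/

section Algorithm

variable {n p : ℕ} (X : Matrix (Fin n) (Fin p) ℝ) (Y : Fin n → ℝ)

lemma colSpan_le_of_col_mem {s t : ℕ} {A : Matrix (Fin p) (Fin s) ℝ} {B : Matrix (Fin p) (Fin t) ℝ}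
    (h : ∀ j, A.col j ∈ colSpan B) : colSpan A ≤ colSpan B :=
  Submodule.span_le.2 (Set.range_subset_iff.2 h)

lemma loadingOf_mem_colSpan {k m : ℕ} (h : k < m) :
    loadingOf (deflated X Y k) Y ∈ colSpan (loadings X Y m) :=
  Submodule.subset_span ⟨⟨k, h⟩, rfl⟩

lemma colSpan_loadings_mono {k m : ℕ} (h : k ≤ m) :
    colSpan (loadings X Y k) ≤ colSpan (loadings X Y m) :=
  colSpan_le_of_col_mem fun j => loadingOf_mem_colSpan X Y (j.2.trans_le h)

lemma exists_of_mem_colSpan_loadings_succ {k : ℕ} {v : Fin p → ℝ}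
    (hv : v ∈ colSpan (loadings X Y (k + 1))) :
    ∃ u ∈ colSpan (loadings X Y k), ∃ a : ℝ, v = u + a • loadingOf (deflated X Y k) Y := by
  refine Submodule.span_induction (p := fun v _ => ∃ u ∈ colSpan (loadings X Y k), ∃ a : ℝ,
    v = u + a • loadingOf (deflated X Y k) Y) ?_ ?_ ?_ ?_ hv
  · rintro _ ⟨j, rfl⟩
    rcases Nat.lt_succ_iff_lt_or_eq.1 j.2 with h | h
    · exact ⟨_, loadingOf_mem_colSpan X Y h, 0, by simp; rfl⟩
    · exact ⟨0, zero_mem _, 1, by simp only [← h, zero_add, one_smul]; rfl⟩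
  · exact ⟨0, zero_mem _, 0, by simp⟩
  · rintro _ _ _ _ ⟨u, hu, a, rfl⟩ ⟨v, hv, b, rfl⟩
    exact ⟨u + v, add_mem hu hv, a + b, by module⟩
  · rintro c _ _ ⟨u, hu, a, rfl⟩
    exact ⟨c • u, Submodule.smul_mem _ c hu, c * a, by module⟩

lemma projLine_mulVec (t z : Fin n → ℝ) : projLine t *ᵥ z = ((t ⬝ᵥ t)⁻¹ * (t ⬝ᵥ z)) • t := by
  rw [projLine, smul_mulVec, vecMulVec_mulVec, ← smul_smul]
  ext; simp [mul_comm]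

lemma projLine_mulVec_self (t : Fin n → ℝ) : projLine t *ᵥ t = t := by
  rw [projLine_mulVec]
  by_cases h : t ⬝ᵥ t = 0
  · simp [dotProduct_self_eq_zero.1 h]
  · rw [inv_mul_cancel₀ h, one_smul]

lemma projLine_transpose (t : Fin n → ℝ) : (projLine t)ᵀ = projLine t := by
  rw [projLine, transpose_smul, transpose_vecMulVec]

lemma deflated_succ_mulVec (k : ℕ) (z : Fin p → ℝ) :
    deflated X Y (k + 1) *ᵥ z = deflated X Y k *ᵥ z -
      projLine (componentOf (deflated X Y k) Y) *ᵥ (deflated X Y k *ᵥ z) := by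
  rw [deflated, sub_mulVec, mulVec_mulVec]

lemma deflated_succ_transpose_mulVec (k : ℕ) (y : Fin n → ℝ) :
    (deflated X Y (k + 1))ᵀ *ᵥ y = (deflated X Y k)ᵀ *ᵥ
      (y - projLine (componentOf (deflated X Y k) Y) *ᵥ y) := by
  rw [deflated, transpose_sub, transpose_mul, projLine_transpose, sub_mulVec, mulVec_sub,
    mulVec_mulVec]

/-- The structure of the deflated design after `k` steps, in terms of the span of the first `k`
loadings. -/
structure DeflationInvariant (k : ℕ) : Prop where
  exists_mulVec_eq : ∀ z, ∃ v ∈ colSpan (loadings X Y k), deflated X Y k *ᵥ z = X *ᵥ (z - v)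
  transpose_mulVec_eq_zero : ∀ v ∈ colSpan (loadings X Y k), (deflated X Y k)ᵀ *ᵥ (X *ᵥ v) = 0
  mulVec_eq_zero : ∀ v ∈ colSpan (loadings X Y k), deflated X Y k *ᵥ v = 0
  transpose_mulVec : ∀ y, ∃ b ∈ colSpan (loadings X Y k),
    (deflated X Y k)ᵀ *ᵥ y = Xᵀ *ᵥ (y - X *ᵥ b)

lemma deflationInvariant (k : ℕ) : DeflationInvariant X Y k := by
  induction k with
  | zero =>
    have h0 : ∀ v ∈ colSpan (loadings X Y 0), v = 0 := by
      intro v hv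
      simpa [colSpan, Set.range_eq_empty] using hv
    exact ⟨fun z => ⟨0, zero_mem _, by simp [deflated]⟩, fun v hv => by simp [h0 v hv],
      fun v hv => by simp [h0 v hv], fun y => ⟨0, zero_mem _, by simp [deflated]⟩⟩
  | succ k ih =>
    obtain ⟨h1, h2, h3, h4⟩ := ih
    set w := loadingOf (deflated X Y k) Y with hw
    set t := componentOf (deflated X Y k) Y with ht
    have htw : t = deflated X Y k *ᵥ w := rfl
    have hwm : w ∈ colSpan (loadings X Y (k + 1)) := loadingOf_mem_colSpan X Y k.lt_succ_self
    have hmono := colSpan_loadings_mono X Y k.le_succ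
    obtain ⟨v₀, hv₀, hv₀t⟩ := h1 w
    rw [← htw] at hv₀t
    -- The component is `t = X (w - v₀)` with `v₀` in the span of the previous loadings; it is
    -- orthogonal to the previous fits `X v`, so deflating by `t` does not disturb them.
    have htX : ∀ v ∈ colSpan (loadings X Y k), t ⬝ᵥ (X *ᵥ v) = 0 := by
      intro v hv
      rw [htw, dotProduct_comm, dotProduct_mulVec, ← mulVec_transpose, h2 v hv, zero_dotProduct]
    have h2' : ∀ v ∈ colSpan (loadings X Y k), (deflated X Y (k + 1))ᵀ *ᵥ (X *ᵥ v) = 0 := by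
      intro v hv
      rw [deflated_succ_transpose_mulVec, projLine_mulVec, htX v hv, mul_zero, zero_smul, sub_zero,
        h2 v hv]
    have h2t : (deflated X Y (k + 1))ᵀ *ᵥ t = 0 := by
      rw [deflated_succ_transpose_mulVec, projLine_mulVec_self, sub_self, mulVec_zero]
    refine ⟨fun z => ?_, fun v hv => ?_, fun v hv => ?_, fun y => ?_⟩
    · obtain ⟨v, hv, hvz⟩ := h1 z
      rw [deflated_succ_mulVec, projLine_mulVec, ← ht, hvz]
      generalize (t ⬝ᵥ t)⁻¹ * (t ⬝ᵥ (X *ᵥ (z - v))) = c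
      refine ⟨v + c • (w - v₀), add_mem (hmono hv)
        (Submodule.smul_mem _ _ (sub_mem hwm (hmono hv₀))), ?_⟩
      rw [hv₀t, ← mulVec_smul, ← mulVec_sub, sub_sub]
    · obtain ⟨u, hu, a, rfl⟩ := exists_of_mem_colSpan_loadings_succ X Y hv
      have hXw : X *ᵥ w = t + X *ᵥ v₀ := by rw [hv₀t, ← mulVec_add, sub_add_cancel]
      rw [mulVec_add, mulVec_add, h2' u hu, mulVec_smul, mulVec_smul, ← hw, hXw, mulVec_add, h2t,
        h2' v₀ hv₀]
      simp
    · obtain ⟨u, hu, a, rfl⟩ := exists_of_mem_colSpan_loadings_succ X Y hv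
      rw [deflated_succ_mulVec, mulVec_add, h3 u hu, mulVec_smul, ← hw, ← htw, ← ht, zero_add,
        mulVec_smul, projLine_mulVec_self, sub_self]
    · rw [deflated_succ_transpose_mulVec, ← ht]
      generalize hd : (deflated X Y k)ᵀ *ᵥ (y - projLine t *ᵥ y) = d
      obtain ⟨b, hb, hby⟩ := h4 (y - projLine t *ᵥ y)
      refine ⟨b + ((t ⬝ᵥ t)⁻¹ * (t ⬝ᵥ y)) • (w - v₀), add_mem (hmono hb)
        (Submodule.smul_mem _ _ (sub_mem hwm (hmono hv₀))), ?_⟩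
      rw [← hd, hby, projLine_mulVec, mulVec_add, mulVec_smul, ← hv₀t]
      congr 1
      abel

lemma loadingOf_eq_zero_iff {A : Matrix (Fin n) (Fin p) ℝ} :
    loadingOf A Y = 0 ↔ Aᵀ *ᵥ Y = 0 := by
  rw [loadingOf, smul_eq_zero, inv_eq_zero, l2norm_eq_zero, or_self]

/-- Each loading is orthogonal to the previous ones. -/
lemma loadingOf_dotProduct_eq_zero {i j : ℕ} (h : i < j) :
    loadingOf (deflated X Y i) Y ⬝ᵥ loadingOf (deflated X Y j) Y = 0 := by
  rw [loadingOf.eq_def (deflated X Y j), dotProduct_smul, dotProduct_mulVec, vecMul_transpose,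
    (deflationInvariant X Y j).mulVec_eq_zero _ (loadingOf_mem_colSpan X Y h), zero_dotProduct,
    smul_zero]

lemma finrank_colSpan_loadings {K : ℕ} (h : ∀ k < K, loadingOf (deflated X Y k) Y ≠ 0) :
    Module.finrank ℝ (colSpan (loadings X Y K)) = K := by
  have hli : LinearIndependent ℝ fun j : Fin K => (loadings X Y K).col j := by
    rw [Fintype.linearIndependent_iff]
    intro g hg j
    have hd := congrArg (fun v => (loadings X Y K).col j ⬝ᵥ v) hg
    simp only [dotProduct_sum, dotProduct_smul, dotProduct_zero] at hd
    rw [Finset.sum_eq_single j] at hd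
    · rcases mul_eq_zero.1 hd with h0 | h0
      · exact h0
      · exact absurd (dotProduct_self_eq_zero.1 h0) (h j j.2)
    · intro i _ hij
      have : (loadings X Y K).col j ⬝ᵥ (loadings X Y K).col i = 0 := by
        rcases lt_or_gt_of_ne hij with h' | h'
        · rw [dotProduct_comm]
          exact loadingOf_dotProduct_eq_zero X Y h'
        · exact loadingOf_dotProduct_eq_zero X Y h'
      rw [this, smul_zero]
    · simp
  exact (finrank_span_eq_card hli).trans (Fintype.card_fin K)

lemma pow_mulVec_mem_colSpan_krylov (S : Matrix (Fin p) (Fin p) ℝ) (s : Fin p → ℝ) {k K : ℕ}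
    (h : k < K) : S ^ k *ᵥ s ∈ colSpan (krylov S s K) :=
  Submodule.subset_span ⟨⟨k, h⟩, rfl⟩

lemma colSpan_krylov_mono (S : Matrix (Fin p) (Fin p) ℝ) (s : Fin p → ℝ) {k m : ℕ} (h : k ≤ m) :
    colSpan (krylov S s k) ≤ colSpan (krylov S s m) :=
  colSpan_le_of_col_mem fun j => pow_mulVec_mem_colSpan_krylov S s (j.2.trans_le h)

lemma mulVec_mem_colSpan_krylov (S : Matrix (Fin p) (Fin p) ℝ) (s : Fin p → ℝ) {k : ℕ}
    {v : Fin p → ℝ} (hv : v ∈ colSpan (krylov S s k)) : S *ᵥ v ∈ colSpan (krylov S s (k + 1)) := by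
  have : colSpan (krylov S s k) ≤ (colSpan (krylov S s (k + 1))).comap S.mulVecLin := by
    refine Submodule.span_le.2 (Set.range_subset_iff.2 fun j => ?_)
    change S *ᵥ (S ^ (j : ℕ) *ᵥ s) ∈ colSpan (krylov S s (k + 1))
    rw [mulVec_mulVec, ← pow_succ']
    exact pow_mulVec_mem_colSpan_krylov S s (Nat.succ_lt_succ j.2)
  exact this hv

/-- The first `K` loadings lie in the empirical Krylov space of order `K`. -/
lemma colSpan_loadings_le_krylov (hn : n ≠ 0) (K : ℕ) :
    colSpan (loadings X Y K) ≤ colSpan (krylov (gramMatrix X) (empCov X Y) K) := by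
  induction K with
  | zero => exact colSpan_le_of_col_mem fun j => j.elim0
  | succ K ih =>
    intro v hv
    obtain ⟨u, hu, a, rfl⟩ := exists_of_mem_colSpan_loadings_succ X Y hv
    refine add_mem (colSpan_krylov_mono _ _ K.le_succ (ih hu)) (Submodule.smul_mem _ _ ?_)
    obtain ⟨b, hb, hbY⟩ := (deflationInvariant X Y K).transpose_mulVec Y
    have hn' : (n : ℝ) ≠ 0 := Nat.cast_ne_zero.2 hn
    have h : Xᵀ *ᵥ (Y - X *ᵥ b) = (n : ℝ) • (empCov X Y - gramMatrix X *ᵥ b) := by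
      rw [empCov, gramMatrix, smul_mulVec, ← smul_sub, smul_smul, mul_one_div_cancel hn', one_smul,
        mulVec_sub, mulVec_mulVec]
    rw [loadingOf, hbY, h]
    refine Submodule.smul_mem _ _ (Submodule.smul_mem _ _ (sub_mem ?_
      (mulVec_mem_colSpan_krylov _ _ (ih hb))))
    simpa using pow_mulVec_mem_colSpan_krylov (gramMatrix X) (empCov X Y) K.succ_pos

/-- A PLS estimate satisfies the normal equations on the span of the loadings. -/
lemma IsPLSEstimate.residual_dotProduct {K : ℕ} {b : Fin p → ℝ} (hb : IsPLSEstimate X Y K b)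
    {c : Fin p → ℝ} (hc : c ∈ colSpan (loadings X Y K)) : (Y - X *ᵥ b) ⬝ᵥ (X *ᵥ c) = 0 := by
  generalize hr₀ : Y - X *ᵥ b = r
  generalize hq : X *ᵥ c = q
  -- The polynomial `‖r - s q‖² - ‖r‖²` in `s` is nonnegative, so its discriminant is not positive.
  have key : ∀ s : ℝ, 0 ≤ (q ⬝ᵥ q) * (s * s) + (-(2 * (r ⬝ᵥ q))) * s + 0 := by
    intro s
    have h := hb.2 (b + s • c) (add_mem hb.1 (Submodule.smul_mem _ _ hc))
    have hr : Y - X *ᵥ (b + s • c) = r - s • q := by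
      rw [mulVec_add, mulVec_smul, sub_add_eq_sub_sub, hr₀, hq]
    rw [hr, hr₀, l2norm_sq, l2norm_sq] at h
    simp only [sub_dotProduct, dotProduct_sub, smul_dotProduct, dotProduct_smul, smul_eq_mul,
      dotProduct_comm q r] at h
    linarith
  have := discrim_le_zero key
  rw [discrim] at this
  nlinarith [sq_nonneg (r ⬝ᵥ q)]

/-- A PLS estimate is a least squares estimate over the empirical Krylov space. If no loading
vanishes, orthogonality of the loadings makes their span the whole Krylov space; if one of them
vanishes, the fit is already the projection of `Y` onto the range of `X`. -/
theorem IsPLSEstimate.leastSquares_krylov {K : ℕ} (hn : n ≠ 0) {b : Fin p → ℝ}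
    (hb : IsPLSEstimate X Y K b) :
    b ∈ colSpan (krylov (gramMatrix X) (empCov X Y) K) ∧
      ∀ c ∈ colSpan (krylov (gramMatrix X) (empCov X Y) K), (Y - X *ᵥ b) ⬝ᵥ (X *ᵥ c) = 0 := by
  have hle := colSpan_loadings_le_krylov X Y hn K
  refine ⟨hle hb.1, ?_⟩
  by_cases h : ∀ k < K, loadingOf (deflated X Y k) Y ≠ 0
  · have heq : colSpan (loadings X Y K) = colSpan (krylov (gramMatrix X) (empCov X Y) K) := by
      refine Submodule.eq_of_le_of_finrank_le hle ?_
      rw [finrank_colSpan_loadings X Y h]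
      exact (finrank_range_le_card (R := ℝ) (fun j : Fin K =>
        (krylov (gramMatrix X) (empCov X Y) K).col j)).trans (Fintype.card_fin K).le
    exact fun c hc => hb.residual_dotProduct X Y (heq ▸ hc)
  · push Not at h
    obtain ⟨k, hk, hk0⟩ := h
    obtain ⟨b₀, hb₀, hbY⟩ := (deflationInvariant X Y k).transpose_mulVec Y
    rw [(loadingOf_eq_zero_iff Y).1 hk0] at hbY
    have h0 : ∀ c, (Y - X *ᵥ b₀) ⬝ᵥ (X *ᵥ c) = 0 := by
      intro c
      rw [dotProduct_mulVec, ← mulVec_transpose, ← hbY, zero_dotProduct]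
    have hd : X *ᵥ (b - b₀) = 0 := by
      have h1 := hb.residual_dotProduct X Y
        (sub_mem hb.1 (colSpan_loadings_mono X Y hk.le hb₀))
      have h2 := h0 (b - b₀)
      have h3 : Y - X *ᵥ b₀ = (Y - X *ᵥ b) + X *ᵥ (b - b₀) := by rw [mulVec_sub]; abel
      rw [h3, add_dotProduct, h1, zero_add] at h2
      exact dotProduct_self_eq_zero.1 h2
    have hfit : X *ᵥ b = X *ᵥ b₀ := by rwa [mulVec_sub, sub_eq_zero] at hd
    exact fun c _ => hfit ▸ h0 c

end Algorithm

/-! ### Krylov spaces in the range of the design -/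

section Krylov

variable {n p : ℕ}

/-- The matrix with columns `A (AᵀA)ʲ Aᵀ y`, `j < K`: the image under `A` of the Krylov components
of `Aᵀ y`. -/
def krylovFit (A : Matrix (Fin n) (Fin p) ℝ) (y : Fin n → ℝ) (K : ℕ) :
    Matrix (Fin n) (Fin K) ℝ :=
  A * krylov (Aᵀ * A) (Aᵀ *ᵥ y) K

lemma mem_colSpan_iff {s : ℕ} {A : Matrix (Fin p) (Fin s) ℝ} {v : Fin p → ℝ} :
    v ∈ colSpan A ↔ ∃ u, A *ᵥ u = v := by
  rw [colSpan, ← range_mulVecLin]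
  rfl

variable (A : Matrix (Fin n) (Fin p) ℝ) (y : Fin n → ℝ) (K : ℕ)

lemma krylovFit_mulVec (u : Fin K → ℝ) :
    krylovFit A y K *ᵥ u = A *ᵥ (krylov (Aᵀ * A) (Aᵀ *ᵥ y) K *ᵥ u) := by
  rw [krylovFit, mulVec_mulVec]

lemma krylovFit_col (j : Fin K) :
    (krylovFit A y K).col j = A *ᵥ ((Aᵀ * A) ^ (j : ℕ) *ᵥ (Aᵀ *ᵥ y)) := rfl

lemma krylovFit_add (x : Fin n → ℝ) :
    krylovFit A (x + y) K = krylovFit A x K + krylovFit A y K := by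
  rw [krylovFit, krylovFit, krylovFit, ← Matrix.mul_add]
  congr 1
  ext i j
  simp [krylov, mulVec_add]

lemma dotProduct_krylovFit_col (x : Fin n → ℝ) (j : Fin K) :
    x ⬝ᵥ (krylovFit A y K).col j = (Aᵀ *ᵥ x) ⬝ᵥ ((Aᵀ * A) ^ (j : ℕ) *ᵥ (Aᵀ *ᵥ y)) := by
  rw [krylovFit_col, dotProduct_mulVec, ← mulVec_transpose A]

lemma krylovFit_col_dotProduct_self (j : Fin K) :
    (krylovFit A y K).col j ⬝ᵥ (krylovFit A y K).col j =
      (Aᵀ *ᵥ y) ⬝ᵥ ((Aᵀ * A) ^ (2 * (j : ℕ) + 1) *ᵥ (Aᵀ *ᵥ y)) := by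
  have hS : ((Aᵀ * A) ^ (j : ℕ))ᵀ = (Aᵀ * A) ^ (j : ℕ) := by
    rw [transpose_pow, transpose_mul, transpose_transpose]
  rw [krylovFit_col]
  generalize Aᵀ *ᵥ y = z
  rw [dotProduct_mulVec, ← mulVec_transpose A, mulVec_mulVec _ Aᵀ, dotProduct_mulVec,
    ← mulVec_transpose, hS, dotProduct_comm, mulVec_mulVec, mulVec_mulVec, ← pow_succ, ← pow_add]
  congr 3
  ring

lemma theta_eq : theta (Aᵀ * A) (Aᵀ *ᵥ y) K = (krylovFit A y K)ᵀ * krylovFit A y K := by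
  rw [theta, krylovFit, transpose_mul]
  simp only [Matrix.mul_assoc]

lemma theta_diag_eq (j : Fin K) :
    theta (Aᵀ * A) (Aᵀ *ᵥ y) K j j =
      (Aᵀ *ᵥ y) ⬝ᵥ ((Aᵀ * A) ^ (2 * (j : ℕ) + 1) *ᵥ (Aᵀ *ᵥ y)) := by
  rw [theta_eq, ← krylovFit_col_dotProduct_self]
  rfl

lemma krylov_transpose_mulVec :
    (krylov (Aᵀ * A) (Aᵀ *ᵥ y) K)ᵀ *ᵥ (Aᵀ *ᵥ y) = (krylovFit A y K)ᵀ *ᵥ y := by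
  rw [krylovFit, transpose_mul, mulVec_mulVec]

lemma posSemidef_transpose_mul_self : (Aᵀ * A).PosSemidef := by
  simpa using posSemidef_conjTranspose_mul_self A

end Krylov

/-! ### The correlation matrix -/

section Correlation

variable {p K : ℕ} {S : Matrix (Fin p) (Fin p) ℝ} {s : Fin p → ℝ}

lemma isHermitian_theta (hS : S.IsHermitian) : (theta S s K).IsHermitian := by
  have hS' : Sᵀ = S := by simpa using hS.eq
  rw [IsHermitian, conjTranspose_eq_transpose_of_trivial, theta, transpose_mul, transpose_mul,
    hS', transpose_transpose, Matrix.mul_assoc]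

lemma isHermitian_corr (hS : S.IsHermitian) : (corr S s K).IsHermitian := by
  have h : (theta S s K)ᵀ = theta S s K := by simpa using (isHermitian_theta hS).eq
  rw [IsHermitian, conjTranspose_eq_transpose_of_trivial, corr, transpose_mul, transpose_mul, h,
    diagInvSqrt, diagonal_transpose, mul_assoc]

/-- A positive lowest eigenvalue of the correlation matrix makes `D` invertible. -/
lemma theta_diag_pos (hS : S.IsHermitian) (hR : 0 < rhoMin (corr S s K)) (j : Fin K) :
    0 < theta S s K j j := by
  by_contra! h
  have h0 : corr S s K j j = 0 := by
    simp [corr, diagInvSqrt, Real.sqrt_eq_zero_of_nonpos h]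
  have := rhoMin_mul_le (isHermitian_corr (s := s) (K := K) hS) (Pi.single j 1)
  simp [h0] at this
  linarith

/-- `Θ = D^(1/2) R D^(1/2)`, applied to a vector. -/
lemma theta_mulVec (hS : S.IsHermitian) (hR : 0 < rhoMin (corr S s K)) (u : Fin K → ℝ)
    (j : Fin K) :
    (theta S s K *ᵥ u) j = Real.sqrt (theta S s K j j) *
      (corr S s K *ᵥ fun i => Real.sqrt (theta S s K i i) * u i) j := by
  simp only [mulVec, dotProduct, Finset.mul_sum]
  refine Finset.sum_congr rfl fun i _ => ?_
  have hi := (Real.sqrt_pos.2 (theta_diag_pos hS hR i)).ne'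
  have hj := (Real.sqrt_pos.2 (theta_diag_pos hS hR j)).ne'
  rw [corr, diagInvSqrt, mul_diagonal, diagonal_mul]
  field_simp

/-- `uᵀ Θ u ≥ ρ_min(R) uᵀ D u`. -/
lemma rhoMin_corr_mul_le (hS : S.IsHermitian) (hR : 0 < rhoMin (corr S s K)) (u : Fin K → ℝ) :
    rhoMin (corr S s K) * ∑ j, theta S s K j j * u j ^ 2 ≤ u ⬝ᵥ (theta S s K *ᵥ u) := by
  have h := rhoMin_mul_le (isHermitian_corr (s := s) (K := K) hS)
    fun i => Real.sqrt (theta S s K i i) * u i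
  have h1 : (fun i => Real.sqrt (theta S s K i i) * u i) ⬝ᵥ
      (fun i => Real.sqrt (theta S s K i i) * u i) = ∑ j, theta S s K j j * u j ^ 2 := by
    refine Finset.sum_congr rfl fun j _ => ?_
    rw [mul_mul_mul_comm, Real.mul_self_sqrt (theta_diag_pos hS hR j).le, sq]
  rw [h1] at h
  refine h.trans (le_of_eq (Finset.sum_congr rfl fun j _ => ?_))
  rw [theta_mulVec hS hR]
  ring

lemma isUnit_theta (hS : S.IsHermitian) (hR : 0 < rhoMin (corr S s K)) :
    IsUnit (theta S s K) := by
  rw [← mulVec_injective_iff_isUnit, ← coe_mulVecLin, ← LinearMap.ker_eq_bot,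
    LinearMap.ker_eq_bot']
  intro u hu
  have h := rhoMin_corr_mul_le hS hR u
  rw [mulVecLin_apply] at hu
  rw [hu, dotProduct_zero] at h
  have h0 : ∑ j, theta S s K j j * u j ^ 2 = 0 :=
    le_antisymm (nonpos_of_mul_nonpos_right h hR)
      (Finset.sum_nonneg fun j _ => mul_nonneg (theta_diag_pos hS hR j).le (sq_nonneg _))
  rw [Finset.sum_eq_zero_iff_of_nonneg
    fun j _ => mul_nonneg (theta_diag_pos hS hR j).le (sq_nonneg _)] at h0
  ext j
  simpa [(theta_diag_pos hS hR j).ne'] using h0 j (Finset.mem_univ j)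

lemma theta_mulVec_lam (hS : S.IsHermitian) (hR : 0 < rhoMin (corr S s K)) :
    theta S s K *ᵥ lam S s K = (krylov S s K)ᵀ *ᵥ s := by
  rw [lam, mulVec_mulVec, mul_nonsing_inv _ ((isUnit_iff_isUnit_det _).1 (isUnit_theta hS hR)),
    one_mulVec]

/-- Weighted Cauchy-Schwarz inequality for a combination of the columns of `B`. -/
lemma mulVec_dotProduct_self_le {ι κ : Type*} [Fintype ι] [Fintype κ] (B : Matrix ι κ ℝ)
    (u : κ → ℝ) {d : κ → ℝ} (hd : ∀ j, 0 < d j) :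
    (B *ᵥ u) ⬝ᵥ (B *ᵥ u) ≤ (∑ j, d j * u j ^ 2) * ∑ j, (B.col j ⬝ᵥ B.col j) / d j := by
  have h : ∀ i, (B *ᵥ u) i * (B *ᵥ u) i ≤ (∑ j, d j * u j ^ 2) * ∑ j, B i j ^ 2 / d j := by
    intro i
    rw [← sq]
    refine Finset.sum_sq_le_sum_mul_sum_of_sq_le_mul Finset.univ
      (fun j _ => mul_nonneg (hd j).le (sq_nonneg _))
      (fun j _ => div_nonneg (sq_nonneg _) (hd j).le) fun j _ => le_of_eq ?_
    have := (hd j).ne'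
    field_simp
  refine (Finset.sum_le_sum fun i _ => h i).trans (le_of_eq ?_)
  rw [← Finset.mul_sum, Finset.sum_comm]
  congr 1
  refine Finset.sum_congr rfl fun j _ => ?_
  rw [← Finset.sum_div]
  congr 1
  exact Finset.sum_congr rfl fun i _ => sq _

/-- Lower bound for `Λ`: since `ΘΛ = Gᵀσ`, each coordinate of `D^(-1/2) Gᵀσ` is controlled by the
Frobenius norm of `R` and by the norm of `D^(1/2) Λ`. -/
lemma krylov_transpose_mulVec_sq_le (hS : S.IsHermitian) (hR : 0 < rhoMin (corr S s K))
    (j : Fin K) :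
    (((krylov S s K)ᵀ *ᵥ s) j) ^ 2 ≤ theta S s K j j * ((∑ i, ∑ l, corr S s K i l ^ 2) *
      (rhoMax (diagPart S s K) * (lam S s K ⬝ᵥ lam S s K))) := by
  rw [← theta_mulVec_lam hS hR, theta_mulVec hS hR, mul_pow,
    Real.sq_sqrt (theta_diag_pos hS hR j).le]
  refine mul_le_mul_of_nonneg_left ?_ (theta_diag_pos hS hR j).le
  refine (Finset.sum_mul_sq_le_sq_mul_sq Finset.univ (fun i => corr S s K j i)
    (fun i => Real.sqrt (theta S s K i i) * lam S s K i)).trans ?_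
  refine mul_le_mul ?_ ?_ (Finset.sum_nonneg fun i _ => sq_nonneg _)
    (Finset.sum_nonneg fun i _ => Finset.sum_nonneg fun l _ => sq_nonneg _)
  · exact Finset.single_le_sum (f := fun i => ∑ l, corr S s K i l ^ 2)
      (fun i _ => Finset.sum_nonneg fun l _ => sq_nonneg _) (Finset.mem_univ j)
  · rw [dotProduct, Finset.mul_sum]
    refine Finset.sum_le_sum fun i _ => ?_
    rw [mul_pow, Real.sq_sqrt (theta_diag_pos hS hR i).le, ← sq]
    exact mul_le_mul_of_nonneg_right
      (le_rhoMax_diagonal (fun i => theta S s K i i) i) (sq_nonneg _)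

end Correlation

/-! ### The deterministic bound -/

/-- A least squares fit `h` of `f + g` is compared with another element `v` of the model: the loss
is that of `v` plus the squared norm `c` of the noise seen by the model. -/
lemma leastSquares_le {ι : Type*} [Fintype ι] {f g h v : ι → ℝ} {c : ℝ}
    (horth : (f + g - h) ⬝ᵥ (h - v) = 0)
    (hc0 : 0 ≤ c) (hc : (g ⬝ᵥ (h - v)) ^ 2 ≤ c * ((h - v) ⬝ᵥ (h - v))) :
    (h - f) ⬝ᵥ (h - f) ≤ (f - v) ⬝ᵥ (f - v) + c := by
  set a := h - v with ha
  have h1 : f - v = a - (h - f) := by rw [ha]; abel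
  have h2 : f + g - h = g - (h - f) := by abel
  have hg : g ⬝ᵥ a = (h - f) ⬝ᵥ a := by
    rw [h2, sub_dotProduct] at horth
    linarith
  have hexp : (f - v) ⬝ᵥ (f - v) =
      a ⬝ᵥ a - 2 * (g ⬝ᵥ a) + (h - f) ⬝ᵥ (h - f) := by
    rw [h1, hg]
    generalize h - f = e
    simp only [sub_dotProduct, dotProduct_sub, dotProduct_comm a e]
    ring
  have ha0 := zero_le_dotProduct_self a
  have : |2 * (g ⬝ᵥ a)| ≤ c + a ⬝ᵥ a := by
    refine abs_le_of_sq_le_sq ?_ (by linarith)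
    nlinarith [sq_nonneg (c - a ⬝ᵥ a)]
  linarith [le_abs_self (2 * (g ⬝ᵥ a))]

lemma sub_dotProduct_self_le {ι : Type*} [Fintype ι] (x y : ι → ℝ) :
    (x - y) ⬝ᵥ (x - y) ≤ 2 * (x ⬝ᵥ x) + 2 * (y ⬝ᵥ y) := by
  have := zero_le_dotProduct_self (x + y)
  simp only [sub_dotProduct, dotProduct_sub, add_dotProduct, dotProduct_add] at this ⊢
  linarith

/-- The population Krylov fit `A G Λ` is the best approximation of `f` in `A [G]`. -/
lemma krylovFit_mulVec_lam_le {n p K : ℕ} (A : Matrix (Fin n) (Fin p) ℝ) (f : Fin n → ℝ)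
    (hR : 0 < rhoMin (corr (Aᵀ * A) (Aᵀ *ᵥ f) K)) (u : Fin K → ℝ) :
    (f - krylovFit A f K *ᵥ lam (Aᵀ * A) (Aᵀ *ᵥ f) K) ⬝ᵥ
        (f - krylovFit A f K *ᵥ lam (Aᵀ * A) (Aᵀ *ᵥ f) K) ≤
      (f - krylovFit A f K *ᵥ u) ⬝ᵥ (f - krylovFit A f K *ᵥ u) := by
  set B := krylovFit A f K
  set l := lam (Aᵀ * A) (Aᵀ *ᵥ f) K
  have hn : Bᵀ *ᵥ (B *ᵥ l) = Bᵀ *ᵥ f := by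
    rw [mulVec_mulVec, ← theta_eq, ← krylov_transpose_mulVec]
    exact theta_mulVec_lam (posSemidef_transpose_mul_self A).1 hR
  have h := leastSquares_le (f := f) (g := 0) (h := B *ᵥ l) (v := B *ᵥ u) (c := 0)
    (by rw [add_zero, ← mulVec_sub, dotProduct_mulVec, ← mulVec_transpose, mulVec_sub, hn,
      sub_self, zero_dotProduct]) le_rfl (by simp)
  rw [add_zero] at h
  rwa [← neg_sub f, neg_dotProduct_neg] at h

/-- Stability of the Krylov fits: if the squared norms of the noise parts of the normalised columns
sum to at most `ρ_min(R) / 32`, the empirical columns remain well conditioned. -/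
lemma sum_theta_mul_sq_le {n p K : ℕ} (A : Matrix (Fin n) (Fin p) ℝ) (f g : Fin n → ℝ)
    (hR : 0 < rhoMin (corr (Aᵀ * A) (Aᵀ *ᵥ f) K))
    (hg : ∑ j, ((krylovFit A g K).col j ⬝ᵥ (krylovFit A g K).col j) /
      theta (Aᵀ * A) (Aᵀ *ᵥ f) K j j ≤ rhoMin (corr (Aᵀ * A) (Aᵀ *ᵥ f) K) / 32)
    (u : Fin K → ℝ) :
    rhoMin (corr (Aᵀ * A) (Aᵀ *ᵥ f) K) *
        ∑ j, theta (Aᵀ * A) (Aᵀ *ᵥ f) K j j * u j ^ 2 ≤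
      4 * ((krylovFit A (f + g) K *ᵥ u) ⬝ᵥ (krylovFit A (f + g) K *ᵥ u)) := by
  have hS := (posSemidef_transpose_mul_self A).1
  have hθ := theta_diag_pos hS hR
  have h1 := rhoMin_corr_mul_le hS hR u
  have h2 := mulVec_dotProduct_self_le (krylovFit A g K) u hθ
  set W := ∑ j, theta (Aᵀ * A) (Aᵀ *ᵥ f) K j j * u j ^ 2
  have hW : 0 ≤ W := Finset.sum_nonneg fun j _ => mul_nonneg (hθ j).le (sq_nonneg _)
  have h3 := h2.trans (mul_le_mul_of_nonneg_left hg hW)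
  have h4 : u ⬝ᵥ (theta (Aᵀ * A) (Aᵀ *ᵥ f) K *ᵥ u) =
      (krylovFit A f K *ᵥ u) ⬝ᵥ (krylovFit A f K *ᵥ u) := by
    rw [theta_eq, ← mulVec_mulVec, dotProduct_mulVec, vecMul_transpose]
  have h5 : krylovFit A f K *ᵥ u = krylovFit A (f + g) K *ᵥ u - krylovFit A g K *ᵥ u := by
    rw [krylovFit_add, add_mulVec, add_sub_cancel_right]
  have h6 := sub_dotProduct_self_le (krylovFit A (f + g) K *ᵥ u) (krylovFit A g K *ᵥ u)
  rw [← h5, ← h4] at h6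
  have h7 := mul_nonneg hR.le hW
  linarith

/-- The squared Frobenius norm of a square matrix. -/
def frobSq {K : ℕ} (R : Matrix (Fin K) (Fin K) ℝ) : ℝ := ∑ i, ∑ l, R i l ^ 2

lemma frobSq_nonneg {K : ℕ} (R : Matrix (Fin K) (Fin K) ℝ) : 0 ≤ frobSq R :=
  Finset.sum_nonneg fun _ _ => Finset.sum_nonneg fun _ _ => sq_nonneg _

/-- The constant of the risk bound, in terms of the deviation level `L` and of `R`. -/
noncomputable def riskConst (L : ℝ) (K : ℕ) (R : Matrix (Fin K) (Fin K) ℝ) : ℝ :=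
  2 * L + 8 * K * L * frobSq R / rhoMin R + L * Real.sqrt (frobSq R) / 4

/-- Lower bound `1 ≤ ρ(S)^(2i) ‖R‖_F² Cond(D) ‖Λ‖²`, `i = j + 1`. It makes the terms of the risk
that do not involve `Λ` comparable with those that do. -/
lemma one_le_rhoMax_pow_mul {n p K : ℕ} (A : Matrix (Fin n) (Fin p) ℝ) (f : Fin n → ℝ)
    (hR : 0 < rhoMin (corr (Aᵀ * A) (Aᵀ *ᵥ f) K)) (j : Fin K) :
    1 ≤ (rhoMax (Aᵀ * A) ^ ((j : ℕ) + 1)) ^ 2 * (frobSq (corr (Aᵀ * A) (Aᵀ *ᵥ f) K) *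
      (cond (diagPart (Aᵀ * A) (Aᵀ *ᵥ f) K) *
        (lam (Aᵀ * A) (Aᵀ *ᵥ f) K ⬝ᵥ lam (Aᵀ * A) (Aᵀ *ᵥ f) K))) := by
  have : Nonempty (Fin K) := ⟨j⟩
  have hS := posSemidef_transpose_mul_self A
  have hθ := theta_diag_pos hS.1 hR
  have h1 := krylov_transpose_mulVec_sq_le hS.1 hR j
  have hx : ((krylov (Aᵀ * A) (Aᵀ *ᵥ f) K)ᵀ *ᵥ (Aᵀ *ᵥ f)) j =
      (Aᵀ *ᵥ f) ⬝ᵥ ((Aᵀ * A) ^ (j : ℕ) *ᵥ (Aᵀ *ᵥ f)) := dotProduct_comm _ _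
  have h2 : theta (Aᵀ * A) (Aᵀ *ᵥ f) K j j ≤ rhoMax (Aᵀ * A) ^ ((j : ℕ) + 1) *
      ((krylov (Aᵀ * A) (Aᵀ *ᵥ f) K)ᵀ *ᵥ (Aᵀ *ᵥ f)) j := by
    have := dotProduct_pow_add_mulVec_le hS j ((j : ℕ) + 1) (Aᵀ *ᵥ f)
    rwa [show (j : ℕ) + (j + 1) = 2 * j + 1 by ring, ← theta_diag_eq, ← hx] at this
  have hmin := rhoMin_diagonal_pos hθ
  have hmin_le := rhoMin_diagonal_le (fun i => theta (Aᵀ * A) (Aᵀ *ᵥ f) K i i) j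
  rw [← frobSq] at h1
  rw [cond]
  set d := diagPart (Aᵀ * A) (Aᵀ *ᵥ f) K with hd
  rw [← diagPart, ← hd] at hmin hmin_le
  have hj := hθ j
  generalize theta (Aᵀ * A) (Aᵀ *ᵥ f) K j j = θ at *
  generalize ((krylov (Aᵀ * A) (Aᵀ *ᵥ f) K)ᵀ *ᵥ (Aᵀ *ᵥ f)) j = x at *
  generalize rhoMax (Aᵀ * A) ^ ((j : ℕ) + 1) = r at *
  generalize frobSq (corr (Aᵀ * A) (Aᵀ *ᵥ f) K) = F at *
  generalize lam (Aᵀ * A) (Aᵀ *ᵥ f) K ⬝ᵥ lam (Aᵀ * A) (Aᵀ *ᵥ f) K = l at *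
  have h3 : θ ^ 2 ≤ r ^ 2 * x ^ 2 := by
    rw [← mul_pow]
    exact pow_le_pow_left₀ hj.le h2 2
  have h4 : θ * θ ≤ θ * (r ^ 2 * (F * (rhoMax d * l))) := by
    calc θ * θ = θ ^ 2 := (sq θ).symm
      _ ≤ r ^ 2 * x ^ 2 := h3
      _ ≤ r ^ 2 * (θ * (F * (rhoMax d * l))) := mul_le_mul_of_nonneg_left h1 (sq_nonneg r)
      _ = _ := by ring
  have h5 := hmin_le.trans (le_of_mul_le_mul_left h4 hj)
  calc (1 : ℝ) = rhoMin d / rhoMin d := (div_self hmin.ne').symm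
    _ ≤ (r ^ 2 * (F * (rhoMax d * l))) / rhoMin d := div_le_div_of_nonneg_right h5 hmin.le
    _ = _ := by ring

/-- The risk bound on the event where the noise satisfies three families of deviation
inequalities, each of the form `gᵀ B g ≤ L s Tr(B)` with `B` positive semidefinite. Here `s`
stands for the variance `τ² / n` of the coordinates of `g`. -/
theorem risk_le {n p K : ℕ} [Nonempty (Fin p)] [Nonempty (Fin K)] (A : Matrix (Fin n) (Fin p) ℝ)
    (f g : Fin n → ℝ) {s L t : ℝ} (hs : 0 < s) (hL : 0 < L)
    (hR : 0 < rhoMin (corr (Aᵀ * A) (Aᵀ *ᵥ f) K))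
    (ht : 32 * L / rhoMin (corr (Aᵀ * A) (Aᵀ *ᵥ f) K) ≤ t)
    (hsnr : ∀ j : Fin K, t * s * K * rhoMax (Aᵀ * A) ^ ((j : ℕ) + 1) *
      ((Aᵀ * A) ^ ((j : ℕ) + 1)).trace ≤ theta (Aᵀ * A) (Aᵀ *ᵥ f) K j j)
    (h₁ : ∀ j : Fin K, (Aᵀ *ᵥ g) ⬝ᵥ ((Aᵀ * A) ^ (j : ℕ) *ᵥ (Aᵀ *ᵥ g)) ≤
      L * s * ((Aᵀ * A) ^ ((j : ℕ) + 1)).trace)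
    (h₂ : ∀ j : Fin K, (Aᵀ *ᵥ g) ⬝ᵥ ((Aᵀ * A) ^ (2 * (j : ℕ) + 1) *ᵥ (Aᵀ *ᵥ g)) ≤
      L * s * ((Aᵀ * A) ^ (2 * ((j : ℕ) + 1))).trace)
    (h₃ : ∀ j : Fin K, (g ⬝ᵥ (krylovFit A f K).col j) ^ 2 ≤
      L * s * theta (Aᵀ * A) (Aᵀ *ᵥ f) K j j)
    {b : Fin p → ℝ} (hb : b ∈ colSpan (krylov (Aᵀ * A) (Aᵀ *ᵥ (f + g)) K))
    (horth : ∀ c ∈ colSpan (krylov (Aᵀ * A) (Aᵀ *ᵥ (f + g)) K),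
      (f + g - A *ᵥ b) ⬝ᵥ (A *ᵥ c) = 0) :
    (A *ᵥ b - f) ⬝ᵥ (A *ᵥ b - f) ≤
      2 * ((f - krylovFit A f K *ᵥ lam (Aᵀ * A) (Aᵀ *ᵥ f) K) ⬝ᵥ
        (f - krylovFit A f K *ᵥ lam (Aᵀ * A) (Aᵀ *ᵥ f) K)) +
      riskConst L K (corr (Aᵀ * A) (Aᵀ *ᵥ f) K) * s *
        max (cond (diagPart (Aᵀ * A) (Aᵀ *ᵥ f) K) * l2norm (lam (Aᵀ * A) (Aᵀ *ᵥ f) K) ^ 2 *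
            ∑ j : Fin K, ((Aᵀ * A) ^ (2 * ((j : ℕ) + 1))).trace)
          (Real.sqrt (cond (diagPart (Aᵀ * A) (Aᵀ *ᵥ f) K) *
            l2norm (lam (Aᵀ * A) (Aᵀ *ᵥ f) K) ^ 2 *
            ∑ j : Fin K, ((Aᵀ * A) ^ ((j : ℕ) + 1)).trace ^ 2)) := by
  have hS := posSemidef_transpose_mul_self A
  have hθ := theta_diag_pos hS.1 hR
  have hone := one_le_rhoMax_pow_mul A f hR
  have hbound := sum_theta_mul_sq_le A f g hR
  have hcond : 1 ≤ cond (diagPart (Aᵀ * A) (Aᵀ *ᵥ f) K) := one_le_cond_diagonal hθ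
  have hρ := rhoMax_nonneg hS
  have hstr := fun j : Fin K => rhoMax_pow_le_trace hS ((j : ℕ) + 1)
  have hstr₂ := fun j : Fin K => rhoMax_pow_le_trace hS (2 * ((j : ℕ) + 1))
  have hg_col : ∀ j, (krylovFit A g K).col j ⬝ᵥ (krylovFit A g K).col j =
    (Aᵀ *ᵥ g) ⬝ᵥ ((Aᵀ * A) ^ (2 * (j : ℕ) + 1) *ᵥ (Aᵀ *ᵥ g)) := krylovFit_col_dotProduct_self A g K
  have hg_le : ∀ j : Fin K, (krylovFit A g K).col j ⬝ᵥ (krylovFit A g K).col j ≤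
      rhoMax (Aᵀ * A) ^ ((j : ℕ) + 1) * (L * s * ((Aᵀ * A) ^ ((j : ℕ) + 1)).trace) := by
    intro j
    have h := dotProduct_pow_add_mulVec_le hS j ((j : ℕ) + 1) (Aᵀ *ᵥ g)
    rw [show (j : ℕ) + (j + 1) = 2 * j + 1 by ring, ← hg_col] at h
    exact h.trans (mul_le_mul_of_nonneg_left (h₁ j) (pow_nonneg hρ _))
  have hgg : ∀ j : Fin K, g ⬝ᵥ (krylovFit A g K).col j ≤
      L * s * ((Aᵀ * A) ^ ((j : ℕ) + 1)).trace := fun j => by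
    rw [dotProduct_krylovFit_col]; exact h₁ j
  have hgg0 : ∀ j : Fin K, 0 ≤ g ⬝ᵥ (krylovFit A g K).col j := fun j => by
    rw [dotProduct_krylovFit_col]
    simpa using (hS.pow (j : ℕ)).dotProduct_mulVec_nonneg (Aᵀ *ᵥ g)
  rw [l2norm_sq]
  set θ := fun j : Fin K => theta (Aᵀ * A) (Aᵀ *ᵥ f) K j j
  set R := corr (Aᵀ * A) (Aᵀ *ᵥ f) K
  set l := lam (Aᵀ * A) (Aᵀ *ᵥ f) K
  set ρ := rhoMin R
  set F := frobSq R with hF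
  set Z := cond (diagPart (Aᵀ * A) (Aᵀ *ᵥ f) K) * (l ⬝ᵥ l)
  set r := fun j : Fin K => rhoMax (Aᵀ * A) ^ ((j : ℕ) + 1)
  set T := fun j : Fin K => ((Aᵀ * A) ^ ((j : ℕ) + 1)).trace
  set T₂ := fun j : Fin K => ((Aᵀ * A) ^ (2 * ((j : ℕ) + 1))).trace
  change (A *ᵥ b - f) ⬝ᵥ (A *ᵥ b - f) ≤ 2 * ((f - krylovFit A f K *ᵥ l) ⬝ᵥ
    (f - krylovFit A f K *ᵥ l)) + riskConst L K R * s *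
      max (Z * ∑ j, T₂ j) (Real.sqrt (Z * ∑ j, T j ^ 2))
  set Z₁ := Z * ∑ j, T₂ j
  set Z₂ := Real.sqrt (Z * ∑ j, T j ^ 2) with hZ₂
  replace hθ : ∀ j, 0 < θ j := hθ
  replace hone : ∀ j, 1 ≤ r j ^ 2 * (F * Z) := hone
  replace hsnr : ∀ j, t * s * K * r j * T j ≤ θ j := hsnr
  replace hg_le : ∀ j, (krylovFit A g K).col j ⬝ᵥ (krylovFit A g K).col j ≤
    r j * (L * s * T j) := hg_le
  replace hgg : ∀ j, g ⬝ᵥ (krylovFit A g K).col j ≤ L * s * T j := hgg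
  replace hstr : ∀ j, r j ≤ T j := hstr
  replace hstr₂ : ∀ j, r j ^ 2 ≤ T₂ j := fun j =>
    (pow_mul' _ _ _).ge.trans (hstr₂ j)
  have hr : ∀ j, 0 ≤ r j := fun j => pow_nonneg hρ _
  have hT : ∀ j, 0 ≤ T j := fun j => (hr j).trans (hstr j)
  have hT₂ : ∀ j, 0 ≤ T₂ j := fun j => (sq_nonneg _).trans (hstr₂ j)
  have hF0 : 0 ≤ F := frobSq_nonneg R
  have hl0 := zero_le_dotProduct_self l
  have hlZ : l ⬝ᵥ l ≤ Z := le_mul_of_one_le_left hl0 hcond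
  have hZ0 : 0 ≤ Z := hl0.trans hlZ
  have hK : (1 : ℝ) ≤ K := by
    exact_mod_cast Fin.pos_iff_nonempty.2 ‹_›
  -- The lower bound on `t` is used in the form `t ρ ≥ 32 L`.
  have ht' : ∀ j, 32 * L * s * K * r j * T j ≤ ρ * θ j := fun j => by
    rw [div_le_iff₀ hR] at ht
    calc 32 * L * s * K * r j * T j = 32 * L * (s * K * r j * T j) := by ring
      _ ≤ (t * ρ) * (s * K * r j * T j) := by
        have := hr j
        have := hT j
        gcongr
      _ = ρ * (t * s * K * r j * T j) := by ring
      _ ≤ ρ * θ j := mul_le_mul_of_nonneg_left (hsnr j) hR.le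
  have hZ₁F : 1 ≤ F * Z₁ := by
    let j : Fin K := Classical.arbitrary _
    calc 1 ≤ r j ^ 2 * (F * Z) := hone j
      _ ≤ (∑ j, T₂ j) * (F * Z) := by
        refine mul_le_mul_of_nonneg_right ((hstr₂ j).trans ?_) (mul_nonneg hF0 hZ0)
        exact Finset.single_le_sum (fun j _ => hT₂ j) (Finset.mem_univ j)
      _ = F * Z₁ := by ring
  have hTZ₂ : ∀ j, T j ≤ r j * (Real.sqrt F * Z₂) := by
    intro j
    refine abs_le_of_sq_le_sq' ?_ (by have := hr j; positivity) |>.2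
    rw [mul_pow, mul_pow, Real.sq_sqrt hF0, hZ₂, Real.sq_sqrt
      (mul_nonneg hZ0 (Finset.sum_nonneg fun j _ => sq_nonneg _))]
    calc T j ^ 2 ≤ T j ^ 2 * (r j ^ 2 * (F * Z)) := le_mul_of_one_le_right (sq_nonneg _) (hone j)
      _ ≤ (∑ j, T j ^ 2) * (r j ^ 2 * (F * Z)) := by
        refine mul_le_mul_of_nonneg_right ?_ (by positivity)
        exact Finset.single_le_sum (f := fun j => T j ^ 2) (fun j _ => sq_nonneg _)
          (Finset.mem_univ j)
      _ = _ := by ring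
  -- The second assumption bounds the squared norm of each normalised noise column by
  -- `ρ / (32 K)`.
  have hnoise : ∑ j, ((krylovFit A g K).col j ⬝ᵥ (krylovFit A g K).col j) / θ j ≤ ρ / 32 := by
    have h : ∀ j, ((krylovFit A g K).col j ⬝ᵥ (krylovFit A g K).col j) / θ j ≤ ρ / (32 * K) := by
      intro j
      rw [div_le_div_iff₀ (hθ j) (by positivity)]
      calc _ ≤ r j * (L * s * T j) * (32 * K) :=
            mul_le_mul_of_nonneg_right (hg_le j) (by positivity)
        _ = 32 * L * s * K * r j * T j := by ring
        _ ≤ _ := ht' j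
    refine (Finset.sum_le_sum fun j _ => h j).trans (le_of_eq ?_)
    rw [Finset.sum_const, Finset.card_univ, Fintype.card_fin, nsmul_eq_mul]
    field_simp
  replace hbound := hbound hnoise
  -- `4 q / ρ` bounds the squared norm of the projection of `g` onto the empirical fits.
  set B := krylovFit A (f + g) K with hB
  set q := ∑ j, (g ⬝ᵥ B.col j) ^ 2 / θ j
  have hq0 : 0 ≤ q := Finset.sum_nonneg fun j _ => div_nonneg (sq_nonneg _) (hθ j).le
  have hq_le : q ≤ K * (2 * L * s) + L * s * (Real.sqrt F * Z₂) * ρ / 16 := by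
    have h : ∀ j, (g ⬝ᵥ B.col j) ^ 2 / θ j ≤
        2 * L * s + L * s * (Real.sqrt F * Z₂) * ρ / (16 * K) := by
      intro j
      have hcol : B.col j = (krylovFit A f K).col j + (krylovFit A g K).col j := by
        rw [hB, krylovFit_add]; rfl
      rw [hcol, dotProduct_add, div_le_iff₀ (hθ j)]
      set x := g ⬝ᵥ (krylovFit A f K).col j
      set y := g ⬝ᵥ (krylovFit A g K).col j
      have hx : x ^ 2 ≤ L * s * θ j := h₃ j
      have hy : y ^ 2 ≤ L * s * (Real.sqrt F * Z₂) * ρ / (32 * K) * θ j := by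
        have hy1 : y ^ 2 ≤ (L * s * T j) ^ 2 := pow_le_pow_left₀ (hgg0 j) (hgg j) 2
        calc y ^ 2 ≤ (L * s * T j) ^ 2 := hy1
          _ = L ^ 2 * s ^ 2 * T j * T j := by ring
          _ ≤ L ^ 2 * s ^ 2 * T j * (r j * (Real.sqrt F * Z₂)) :=
            mul_le_mul_of_nonneg_left (hTZ₂ j) (by have := hT j; positivity)
          _ = L * s * (Real.sqrt F * Z₂) / (32 * K) * (32 * L * s * K * r j * T j) := by
            field_simp
          _ ≤ L * s * (Real.sqrt F * Z₂) / (32 * K) * (ρ * θ j) :=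
            mul_le_mul_of_nonneg_left (ht' j) (by positivity)
          _ = _ := by ring
      calc (x + y) ^ 2 ≤ 2 * x ^ 2 + 2 * y ^ 2 := by linarith [sq_nonneg (x - y)]
        _ ≤ 2 * (L * s * θ j) + 2 * (L * s * (Real.sqrt F * Z₂) * ρ / (32 * K) * θ j) := by
          linarith
        _ = _ := by ring
    refine (Finset.sum_le_sum fun j _ => h j).trans (le_of_eq ?_)
    rw [Finset.sum_const, Finset.card_univ, Fintype.card_fin, nsmul_eq_mul]
    field_simp
  -- Comparison of the fit with the empirical Krylov combination of coefficients `Λ`.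
  obtain ⟨u, hu⟩ := mem_colSpan_iff.1 hb
  have hfit : A *ᵥ b = B *ᵥ u := by rw [hB, krylovFit_mulVec, hu]
  have hls := leastSquares_le (f := f) (g := g) (h := A *ᵥ b) (v := B *ᵥ l) (c := 4 / ρ * q)
    (by
      rw [hfit, ← mulVec_sub, ← hfit, hB, krylovFit_mulVec]
      exact horth _ (mem_colSpan_iff.2 ⟨_, rfl⟩))
    (by positivity)
    (by
      rw [hfit, ← mulVec_sub]
      set a := u - l
      have h1 : (g ⬝ᵥ (B *ᵥ a)) ^ 2 ≤ (∑ j, θ j * a j ^ 2) * q := by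
        have : g ⬝ᵥ (B *ᵥ a) = ∑ j, a j * (g ⬝ᵥ B.col j) := by
          rw [dotProduct_mulVec]
          exact Finset.sum_congr rfl fun j _ => mul_comm _ _
        rw [this]
        refine Finset.sum_sq_le_sum_mul_sum_of_sq_le_mul Finset.univ
          (fun j _ => mul_nonneg (hθ j).le (sq_nonneg _))
          (fun j _ => div_nonneg (sq_nonneg _) (hθ j).le) fun j _ => le_of_eq ?_
        have := (hθ j).ne'
        field_simp
      have h2 : ∑ j, θ j * a j ^ 2 ≤ 4 / ρ * ((B *ᵥ a) ⬝ᵥ (B *ᵥ a)) := by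
        rw [div_mul_eq_mul_div, le_div_iff₀ hR, mul_comm]
        exact hbound a
      calc _ ≤ _ := h1
        _ ≤ _ := mul_le_mul_of_nonneg_right h2 hq0
        _ = _ := by ring)
  have hΛ : (krylovFit A g K *ᵥ l) ⬝ᵥ (krylovFit A g K *ᵥ l) ≤ L * s * Z₁ := by
    have h := mulVec_dotProduct_self_le (krylovFit A g K) l (d := fun _ => 1) fun _ => one_pos
    have hll : ∑ j, 1 * l j ^ 2 = l ⬝ᵥ l := Finset.sum_congr rfl fun j _ => by ring
    simp only [div_one] at h
    rw [hll] at h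
    calc _ ≤ _ := h
      _ ≤ Z * ∑ j, L * s * T₂ j := by
        refine mul_le_mul hlZ (Finset.sum_le_sum fun j _ => (hg_col j).le.trans (h₂ j))
          (Finset.sum_nonneg fun j _ => zero_le_dotProduct_self _) hZ0
      _ = L * s * Z₁ := by rw [← Finset.mul_sum]; ring
  have hsplit : (f - B *ᵥ l) ⬝ᵥ (f - B *ᵥ l) ≤
      2 * ((f - krylovFit A f K *ᵥ l) ⬝ᵥ (f - krylovFit A f K *ᵥ l)) + 2 * (L * s * Z₁) := by
    have h := sub_dotProduct_self_le (f - krylovFit A f K *ᵥ l) (krylovFit A g K *ᵥ l)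
    rw [sub_sub, ← add_mulVec, ← krylovFit_add] at h
    linarith
  -- The part of `q` free of `Λ` is absorbed through `1 ≤ F Z₁`.
  set M := max Z₁ Z₂
  have hM₁ : Z₁ ≤ M := le_max_left _ _
  have hM₂ : Z₂ ≤ M := le_max_right _ _
  have hfinal : 4 / ρ * q ≤ 8 * K * L * F / ρ * s * M + L * Real.sqrt F / 4 * s * M := by
    calc 4 / ρ * q ≤ 4 / ρ * (K * (2 * L * s) + L * s * (Real.sqrt F * Z₂) * ρ / 16) :=
          mul_le_mul_of_nonneg_left hq_le (by positivity)
      _ = 8 * K * L / ρ * s * 1 + L * Real.sqrt F / 4 * s * Z₂ := by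
        field_simp
        ring
      _ ≤ 8 * K * L / ρ * s * (F * M) + L * Real.sqrt F / 4 * s * M := by
        have h1 : 1 ≤ F * M := hZ₁F.trans (mul_le_mul_of_nonneg_left hM₁ hF0)
        gcongr
      _ = _ := by ring
  have hLM : L * s * Z₁ ≤ L * s * M := by gcongr
  have hC : riskConst L K R * s * M = 2 * (L * s * M) +
      (8 * K * L * F / ρ * s * M + L * Real.sqrt F / 4 * s * M) := by
    rw [riskConst, ← hF]
    ring
  rw [hC]
  linarith

/-! ### Scaling and indexing -/

section Smoothing

variable {n p : ℕ} (A : Matrix (Fin n) (Fin p) ℝ) (k : ℕ)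

lemma trace_mul_pow_mul_transpose :
    (A * (Aᵀ * A) ^ k * Aᵀ).trace = ((Aᵀ * A) ^ (k + 1)).trace := by
  rw [trace_mul_comm, ← Matrix.mul_assoc, pow_succ']

lemma posSemidef_mul_pow_mul_transpose : (A * (Aᵀ * A) ^ k * Aᵀ).PosSemidef := by
  simpa using ((posSemidef_transpose_mul_self A).pow k).mul_mul_conjTranspose_same A

lemma dotProduct_mul_pow_mul_transpose (x : Fin n → ℝ) :
    x ⬝ᵥ ((A * (Aᵀ * A) ^ k * Aᵀ) *ᵥ x) = (Aᵀ *ᵥ x) ⬝ᵥ ((Aᵀ * A) ^ k *ᵥ (Aᵀ *ᵥ x)) := by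
  rw [← mulVec_mulVec, ← mulVec_mulVec, dotProduct_mulVec, ← mulVec_transpose A]

end Smoothing

lemma sum_Icc_one_eq {M : Type*} [AddCommMonoid M] (h : ℕ → M) (K : ℕ) :
    ∑ i ∈ Finset.Icc 1 K, h i = ∑ j : Fin K, h ((j : ℕ) + 1) := by
  induction K with
  | zero => simp
  | succ K ih =>
    rw [Finset.sum_Icc_succ_top (Nat.le_add_left 1 K), ih, Fin.sum_univ_castSucc]
    simp

lemma smul_dotProduct_smul_self {ι : Type*} [Fintype ι] (c : ℝ) (x : ι → ℝ) :
    (c • x) ⬝ᵥ (c • x) = c ^ 2 * l2norm x ^ 2 := by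
  rw [l2norm_sq, smul_dotProduct, dotProduct_smul, smul_eq_mul, smul_eq_mul]
  ring

end PLS

/-- The constant `C δ K R` depends on `δ` and on the `K × K` correlation matrix `R` only. -/
theorem theorem3p1 :
    ∃ C : ℝ → (K : ℕ) → Matrix (Fin K) (Fin K) ℝ → ℝ,
      ∀ (n p K : ℕ), 1 ≤ K → K ≤ p →
      ∀ (X : Matrix (Fin n) (Fin p) ℝ) (β : Fin p → ℝ) (τ : ℝ), 0 < τ →
      ∀ δ : ℝ, 0 < δ → δ < 1 →
      ∀ (Ω : Type*) [MeasurableSpace Ω] (P : Measure Ω) [IsProbabilityMeasure P]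
        (ε : Ω → EuclideanSpace ℝ (Fin n)),
      HasLaw ε (multivariateGaussian 0 (τ ^ 2 • (1 : Matrix (Fin n) (Fin n) ℝ))) P →
      ∀ (S : Matrix (Fin p) (Fin p) ℝ) (σ : Fin p → ℝ) (D R : Matrix (Fin K) (Fin K) ℝ)
        (Λ : Fin K → ℝ),
      S = PLS.gramMatrix X → σ = PLS.popCov P X β ε →
      D = PLS.diagPart S σ K → R = PLS.corr S σ K → Λ = PLS.lam S σ K →
      -- first assumption
      0 < PLS.rhoMin R →
      -- second assumption
      ∀ t : ℝ, 128 * Real.log (6 * K / δ) / PLS.rhoMin R ≤ t →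
      (∀ i ∈ Finset.Icc 1 K,
        t * (τ ^ 2 / n) * K * PLS.rhoMax S ^ i * (S ^ i).trace ≤ σ ⬝ᵥ (S ^ (2 * i - 1) *ᵥ σ)) →
      ∀ βhat : Ω → Fin p → ℝ,
      (∀ ω, PLS.IsPLSEstimate X (PLS.response X β (ε ω)) K (βhat ω)) →
      ENNReal.ofReal (1 - δ) ≤
        P {ω | 1 / (n : ℝ) * PLS.l2norm (X *ᵥ βhat ω - X *ᵥ β) ^ 2 ≤
          2 / (n : ℝ) * (⨅ v : PLS.colSpan (PLS.krylov S σ K),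
              PLS.l2norm (X *ᵥ (β - (v : Fin p → ℝ))) ^ 2)
            + C δ K R * (τ ^ 2 / n) *
              max (PLS.cond D * PLS.l2norm Λ ^ 2 *
                    ∑ i ∈ Finset.Icc 1 K, (S ^ (2 * i)).trace)
                (Real.sqrt (PLS.cond D * PLS.l2norm Λ ^ 2 *
                    ∑ i ∈ Finset.Icc 1 K, (S ^ i).trace ^ 2))} := by
  refine ⟨fun δ K R => PLS.riskConst (4 * Real.log (6 * K / δ)) K R, ?_⟩
  intro n p K hK hKp X β τ hτ δ hδ hδ1 Ω _ P _ ε hε S σ D R Λ hS hσ hD hRdef hΛ hR t ht hsnr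
    βhat hβ
  have : Nonempty (Fin K) := ⟨⟨0, hK⟩⟩
  have : Nonempty (Fin p) := ⟨⟨0, hK.trans hKp⟩⟩
  subst hD hRdef hΛ
  rw [PLS.popCov_eq hε, ← hS] at hσ
  -- For `n = 0` the junk value `1 / n = 0` makes `S`, hence `R`, vanish.
  have hn : n ≠ 0 := by
    rintro rfl
    have hS0 : S = 0 := by rw [hS]; simp [PLS.gramMatrix]
    have h := PLS.theta_diag_pos (by rw [hS0]; exact isHermitian_zero) hR
      (Classical.arbitrary (Fin K))
    simp [PLS.theta, hS0] at h
  have hn0 : (0 : ℝ) < n := by positivity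
  have hK0 : (1 : ℝ) ≤ K := by exact_mod_cast hK
  have hδ6 : 1 < 6 * (K : ℝ) / δ := by rw [one_lt_div hδ]; linarith
  set L := 4 * Real.log (6 * K / δ) with hLdef
  have hL : 0 < L := mul_pos four_pos (Real.log_pos hδ6)
  -- Here `c = 1 / √n`; with `A = X / √n` the factor `1 / n` disappears from `S = AᵀA`.
  obtain ⟨c, hc⟩ : ∃ c : ℝ, c ^ 2 = 1 / n := ⟨Real.sqrt (1 / n), Real.sq_sqrt (by positivity)⟩
  set A := c • X with hA
  set f := A *ᵥ β with hf
  have hAA : Aᵀ * A = S := by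
    rw [hA, hS, PLS.gramMatrix, transpose_smul, smul_mul, Matrix.mul_smul, smul_smul, ← sq, hc]
  have hAf : Aᵀ *ᵥ f = σ := by rw [hf, mulVec_mulVec, hAA, hσ]
  -- In order: the forms `gᵀ A Sʲ Aᵀ g`, `‖A Sʲ Aᵀ g‖²` and `⟨g, A Sʲ σ⟩²`.
  let Q : Fin K ⊕ Fin K ⊕ Fin K → Matrix (Fin n) (Fin n) ℝ :=
    Sum.elim (fun j => A * (Aᵀ * A) ^ (j : ℕ) * Aᵀ)
      (Sum.elim (fun j => A * (Aᵀ * A) ^ (2 * (j : ℕ) + 1) * Aᵀ)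
        (fun j => vecMulVec ((PLS.krylovFit A f K).col j) ((PLS.krylovFit A f K).col j)))
  have hQ : ∀ i, (Q i).PosSemidef := by
    rintro (j | j | j)
    · exact PLS.posSemidef_mul_pow_mul_transpose A j
    · exact PLS.posSemidef_mul_pow_mul_transpose A (2 * j + 1)
    · exact posSemidef_vecMulVec_self_star ((PLS.krylovFit A f K).col j)
  have hprob := PLS.le_measure_forall_quadraticForm_le hτ hε hQ L
  -- Since `exp (-L / 4) = δ / (6 K)`, the `3 K` forms fail with total probability `≤ δ √2 / 2`.
  have hδle : 1 - δ ≤ 1 - Fintype.card (Fin K ⊕ Fin K ⊕ Fin K) *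
      (Real.sqrt 2 * Real.exp (-(L / 4))) := by
    have hcard : (Fintype.card (Fin K ⊕ Fin K ⊕ Fin K) : ℝ) = 3 * K := by
      simp only [Fintype.card_sum, Fintype.card_fin]
      push_cast
      ring
    have hexp : Real.exp (-(L / 4)) = δ / (6 * K) := by
      rw [hLdef, mul_div_cancel_left₀ _ four_ne_zero, Real.exp_neg, Real.exp_log (by linarith),
        inv_div]
    have h2 : Real.sqrt 2 ≤ 2 := by
      rw [Real.sqrt_le_left (by norm_num)]
      norm_num
    rw [hcard, hexp]
    have : 3 * K * (Real.sqrt 2 * (δ / (6 * K))) = Real.sqrt 2 / 2 * δ := by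
      field_simp
      norm_num
    rw [this]
    nlinarith
  refine (ENNReal.ofReal_le_ofReal hδle).trans (hprob.trans (measure_mono fun ω hω => ?_))
  rw [Set.mem_ofPred_eq] at hω ⊢
  set e := (ε ω).ofLp
  set g := c • e with hg
  have hgg : ∀ i, g ⬝ᵥ (Q i *ᵥ g) ≤ L * (τ ^ 2 / n) * (Q i).trace := by
    intro i
    calc g ⬝ᵥ (Q i *ᵥ g) = c ^ 2 * (e ⬝ᵥ (Q i *ᵥ e)) := by
          rw [hg, mulVec_smul, smul_dotProduct, dotProduct_smul, smul_eq_mul, smul_eq_mul]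
          ring
      _ ≤ c ^ 2 * (L * τ ^ 2 * (Q i).trace) := mul_le_mul_of_nonneg_left (hω i) (sq_nonneg c)
      _ = L * (τ ^ 2 / n) * (Q i).trace := by rw [hc]; ring
  have hY : c • PLS.response X β (ε ω) = f + g := by
    rw [PLS.response, smul_add, hf, hA, smul_mulVec]
  have hcov : PLS.empCov X (PLS.response X β (ε ω)) = Aᵀ *ᵥ (f + g) := by
    rw [← hY, PLS.empCov, hA, transpose_smul, smul_mulVec, mulVec_smul, smul_smul, ← sq, hc]
  obtain ⟨hb, horth⟩ := (hβ ω).leastSquares_krylov X (PLS.response X β (ε ω)) hn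
  rw [← hS, ← hAA, hcov] at hb horth
  rw [← hAA, ← hAf] at hR ht hsnr ⊢
  have hrisk := PLS.risk_le A f g (s := τ ^ 2 / n) (L := L) (t := t) (K := K) (b := βhat ω)
    (by positivity) hL hR (le_trans (by rw [hLdef]; ring_nf; rfl) ht)
    (fun j => by
      have h := hsnr (j + 1) (Finset.mem_Icc.2 ⟨Nat.le_add_left _ _, j.2⟩)
      rwa [show 2 * ((j : ℕ) + 1) - 1 = 2 * j + 1 by omega, ← PLS.theta_diag_eq] at h)
    (fun j => by
      have h := hgg (.inl j)
      simp only [Q, Sum.elim_inl] at h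
      rwa [PLS.dotProduct_mul_pow_mul_transpose, PLS.trace_mul_pow_mul_transpose] at h)
    (fun j => by
      have h := hgg (.inr (.inl j))
      simp only [Q, Sum.elim_inl, Sum.elim_inr] at h
      rwa [PLS.dotProduct_mul_pow_mul_transpose, PLS.trace_mul_pow_mul_transpose] at h)
    (fun j => by
      have h := hgg (.inr (.inr j))
      simp only [Q, Sum.elim_inr] at h
      rw [vecMulVec_mulVec, trace_vecMulVec, PLS.krylovFit_col_dotProduct_self,
        ← PLS.theta_diag_eq] at h
      refine le_trans (le_of_eq ?_) h
      simp [sq, dotProduct_comm])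
    hb
    (fun v hv => by
      have h := horth v hv
      have hr : f + g - A *ᵥ βhat ω = c • (PLS.response X β (ε ω) - X *ᵥ βhat ω) := by
        rw [smul_sub, hY, hA, smul_mulVec]
      rw [hr, hA, smul_mulVec, smul_dotProduct, dotProduct_smul, h, smul_zero, smul_zero])
  rw [PLS.sum_Icc_one_eq (fun i => ((Aᵀ * A) ^ (2 * i)).trace),
    PLS.sum_Icc_one_eq (fun i => ((Aᵀ * A) ^ i).trace ^ 2)]
  have hleft : 1 / (n : ℝ) * PLS.l2norm (X *ᵥ βhat ω - X *ᵥ β) ^ 2 =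
      (A *ᵥ βhat ω - f) ⬝ᵥ (A *ᵥ βhat ω - f) := by
    rw [hf, hA, smul_mulVec, smul_mulVec, ← smul_sub, PLS.smul_dotProduct_smul_self, hc]
  have hinf : (n : ℝ) * ((f - PLS.krylovFit A f K *ᵥ PLS.lam (Aᵀ * A) (Aᵀ *ᵥ f) K) ⬝ᵥ
      (f - PLS.krylovFit A f K *ᵥ PLS.lam (Aᵀ * A) (Aᵀ *ᵥ f) K)) ≤
      ⨅ v : PLS.colSpan (PLS.krylov (Aᵀ * A) (Aᵀ *ᵥ f) K),
        PLS.l2norm (X *ᵥ (β - (v : Fin p → ℝ))) ^ 2 := by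
    refine le_ciInf fun v => ?_
    obtain ⟨u, hu⟩ := PLS.mem_colSpan_iff.1 v.2
    have h := PLS.krylovFit_mulVec_lam_le A f hR u
    have hd : f - PLS.krylovFit A f K *ᵥ u = c • (X *ᵥ (β - (v : Fin p → ℝ))) := by
      rw [PLS.krylovFit_mulVec, hu, ← smul_mulVec, ← hA, mulVec_sub, ← hf]
    rw [hd, PLS.smul_dotProduct_smul_self, hc, one_div_mul_eq_div, le_div_iff₀ hn0] at h
    linarith
  rw [hleft]
  refine hrisk.trans (add_le_add ?_ le_rfl)
  rw [div_mul_eq_mul_div, le_div_iff₀ hn0]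
  linarith
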